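/- **Language.** Types are $\tau,\sigma ::= \mathbf{real} \mid \tau_1 * \cdots * \tau_n \mid \sigma\to\tau \mid \{C_1\,\tau_1 \mid \cdots \mid C_n\,\tau_n\} \mid \mathbf{list}(\tau)$ with $n\ge 0$. The well-typed terms $\Gamma\vdash t:\tau$ are those of the simply typed $\lambda$-calculus with variables, constants $\underline c:\mathbf{real}$ ($c\in\mathbb R$), $t+u$, $t*u$ and $\varsigma(t)$ on $\mathbf{real}$, tuples $\langle t_1,\dots,t_n\rangle$ and tuple matching, $\lambda$-abstraction and application, variant constructors $C_i\,t$ and case distinction, $[\,]$, $t::u$ and $\mathrm{fold}\,(x_1,x_2).t\ \mathrm{over}\ u\ \mathrm{from}\ v$ on lists. A type is *first order* (ground) if it contains no function type, and a context is first order if all its types are. **Semantics.** Types denote diffeological spaces: $[\![\mathbf{real}]\!]=\mathbb R$, products denote products, $[\![\sigma\to\tau]\!]$ is the space of smooth maps with the functional diffeology, variants denote disjoint unions, and $[\![\mathbf{list}(\tau)]\!]=\biguplus_{m\ge 0}[\![\tau]\!]^m$. A context denotes the product of its types, and a term $\Gamma\vdash t:\tau$ denotes a smooth map $[\![t]\!]:[\![\Gamma]\!]\to[\![\tau]\!]$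 in the usual way, with $\varsigma(x)=1/(1+e^{-x})$. **Translations.** Fix $k\ge 0$. The type translations $D^k$ and $D_{rev}^k$ commute with all type formers other than $\mathbf{real}$, and $D^k(\mathbf{real})=\mathbf{real}*\mathbf{real}^k$, $D_{rev}^k(\mathbf{real})=\mathbf{real}*(\mathbf{real}\to\mathbf{real}^k)$. On terms, $D_{rev}^k$ commutes with all term formers except - $D_{rev}^k(\underline c)=\langle\underline c,\lambda z.\langle\underline 0,\dots,\underline 0\rangle\rangle$, - $D_{rev}^k(t+u)=\langle x+y,\ \lambda z.\,x'z+y'z\rangle$, - $D_{rev}^k(t*u)=\langle x*y,\ \lambda z.\,x'(y*z)+y'(x*z)\rangle$, - $D_{rev}^k(\varsigma(t))=\mathrm{let}\ y=\varsigma(x)\ \mathrm{in}\ \langle y,\ \lambda z.\,x'(y*(1-y)*z)\rangle$, where $D_{rev}^k(t)$ and $D_{rev}^k(u)$ are matched with $\langle x,x'\rangle$ and $\langle y,y'\rangle$ (in the last line $D_{rev}^k(t)$ is matched with $\langle x,x'\rangle$). For first order $\tau$ the closed terms $\mathrm{lamR}_\tau:D^k\tau\to D_{rev}^k\tau$ and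 $\mathrm{evR}_\tau:D_{rev}^k\tau\to D^k\tau$ act componentwise on products, variants and lists, and at $\mathbf{real}$ they are $\langle x,\langle x_1',\dots,x_k'\rangle\rangle\mapsto\langle x,\lambda y.\langle x_1'*y,\dots,x_k'*y\rangle\rangle$ and $\langle x,x'\rangle\mapsto\langle x,x'\,\underline 1\rangle$. For $\Gamma\vdash t:\tau$ with $\Gamma$ and $\tau$ first order, $\mathrm{lamR}_\Gamma;D_{rev}^k(t);\mathrm{evR}_\tau$ is the term $D^k\Gamma\vdash\mathrm{evR}_\tau\big(D_{rev}^k(t)[\mathrm{lamR}_\sigma\,x/x]_{(x:\sigma)\in\Gamma}\big):D^k\tau$. **Tangent functor.** For $M=[\![\tau]\!]$ or $[\![\Gamma]\!]$ with $\tau$, $\Gamma$ first order (a manifold, with components of possibly different dimensions), $T_xM$ is the set of smooth curves $\gamma:\mathbb R\to M$ with $\gamma(0)=x$, where $\gamma_1\sim\gamma_2$ iff $(f\circ\gamma_1)'(0)=(f\circ\gamma_2)'(0)$ for all smooth $f:M\to\mathbb R$. $T^kM$ is the $k$-fold fibre product over $M$ of the tangent bundle $TM$ with itself; its points are $(x,(v_1,\dots,v_k))$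 with $v_j\in T_xM$. For smooth $f:M\to N$, $T^kf(x,([\gamma_j])_j)=(f(x),([f\circ\gamma_j])_j)$. The canonical maps $\phi_\tau:[\![D^k\tau]\!]\to T^k[\![\tau]\!]$ and $\phi_\Gamma:[\![D^k\Gamma]\!]\to T^k[\![\Gamma]\!]$ are defined by induction, by $\phi_{\mathbf{real}}(x,x')=(x,([s\mapsto x+x_j's])_j)$ at $\mathbf{real}$, and through the canonical isomorphisms $\prod_iT^kM_i\cong T^k\prod_iM_i$ and $\biguplus_iT^kM_i\cong T^k\biguplus_iM_i$ at the other types and at contexts. **Theorem (semantic correctness of $D_{rev}^k$).** Let $k\ge 0$, let $\tau$ be a first order type, $\Gamma$ a first order context and $\Gamma\vdash t:\tau$ a term (which may use function types internally). Then $\phi_\Gamma$ and $\phi_\tau$ are isomorphisms (diffeomorphisms), and $$\phi_\tau\circ[\![\mathrm{lamR}_\Gamma;D_{rev}^k(t);\mathrm{evR}_\tau]\!]\;=\;T^k[\![t]\!]\circ\phi_\Gamma .$$ -/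

import Mathlib

open Diffeology
open scoped ContDiff

noncomputable section

namespace RevAD

/-! ## Diffeological spaces

Diffeologies are Mathlib's `DiffeologicalSpace`, whose plots are parametrised by the spaces `ℝⁿ`.
This gives the same category as plots parametrised by open subsets of the `ℝⁿ`. -/

/-- The diffeology on `X` induced by a map into a diffeological space. -/
@[reducible]
def induced {X Y : Type} (f : X → Y) (d : DiffeologicalSpace Y) : DiffeologicalSpace X where
  plots n := {p | IsPlot (f ∘ p)}
  constant_plots x := DiffeologicalSpace.constant_plots (f x)
  plot_reparam hp hf := DiffeologicalSpace.plot_reparam hp hf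
  locality {_ p} hp := DiffeologicalSpace.locality (p := f ∘ p) fun x ↦ by
    obtain ⟨u, hu, hxu, h⟩ := hp x
    exact ⟨u, hu, hxu, fun hfu hf ↦ h hfu hf⟩

theorem isPlot_induced {X Y : Type} {f : X → Y} {d : DiffeologicalSpace Y} {n : ℕ}
    {p : EuclideanSpace ℝ (Fin n) → X} : @IsPlot X (induced f d) n p ↔ IsPlot (f ∘ p) :=
  Iff.rfl

/-- A diffeological space, bundled. -/
structure DiffSp where
  carrier : Type
  str : DiffeologicalSpace carrier

instance : CoeSort DiffSp Type := ⟨DiffSp.carrier⟩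

instance (X : DiffSp) : DiffeologicalSpace X := X.str

/-- Smooth maps between diffeological spaces. -/
@[ext]
structure Hom (X Y : DiffSp) where
  toFun : X → Y
  smooth : DSmooth toFun

instance (X Y : DiffSp) : CoeFun (Hom X Y) (fun _ ↦ X → Y) := ⟨Hom.toFun⟩

namespace DiffSp

/-- The real line with its usual diffeology. -/
def real : DiffSp := ⟨ℝ, inferInstance⟩

/-- Euclidean space with its usual diffeology. -/
def euc (n : ℕ) : DiffSp := ⟨EuclideanSpace ℝ (Fin n), inferInstance⟩

/-- The one-point space. -/
def unit : DiffSp := ⟨Unit, ⊤⟩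

/-- Binary products, with the product diffeology. -/
def prod (X Y : DiffSp) : DiffSp := ⟨X × Y, induced Prod.fst X.str ⊓ induced Prod.snd Y.str⟩

/-- Products of families, with the product diffeology. -/
def pi {ι : Type} (X : ι → DiffSp) : DiffSp :=
  ⟨∀ i, X i, ⨅ i, induced (fun x : (∀ i, X i) ↦ x i) (X i).str⟩

theorem isPlot_unit {n : ℕ} (p : EuclideanSpace ℝ (Fin n) → unit) : IsPlot p :=
  DiffeologicalSpace.constant_plots (X := unit) ()

theorem isPlot_prod {X Y : DiffSp} {n : ℕ} {p : EuclideanSpace ℝ (Fin n) → prod X Y} :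
    IsPlot p ↔ IsPlot (fun u ↦ (p u).1) ∧ IsPlot (fun u ↦ (p u).2) :=
  DiffeologicalSpace.isPlot_inf_iff

theorem isPlot_pi {ι : Type} {X : ι → DiffSp} {n : ℕ} {p : EuclideanSpace ℝ (Fin n) → pi X} :
    IsPlot p ↔ ∀ i, IsPlot (fun u ↦ p u i) :=
  DiffeologicalSpace.isPlot_iInf_iff

theorem isPlot_real {n : ℕ} {p : EuclideanSpace ℝ (Fin n) → ℝ} :
    IsPlot (X := real) p ↔ ContDiff ℝ ∞ p :=
  Iff.rfl

theorem isPlot_euc {m n : ℕ} {p : EuclideanSpace ℝ (Fin n) → EuclideanSpace ℝ (Fin m)} :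
    IsPlot (X := euc m) p ↔ ContDiff ℝ ∞ p :=
  Iff.rfl

/-- Disjoint unions of families. Since `ℝⁿ` is connected, a decomposition of `ℝⁿ` into disjoint
open sets, each mapped smoothly to one summand, is trivial: a plot is a plot of one summand. -/
def sigma {ι : Type} (X : ι → DiffSp) : DiffSp where
  carrier := Σ i, X i
  str :=
    { plots n := {p | ∃ (i : ι) (q : EuclideanSpace ℝ (Fin n) → X i),
        IsPlot q ∧ p = fun u ↦ ⟨i, q u⟩}
      constant_plots := fun x ↦ ⟨x.1, fun _ ↦ x.2, DiffeologicalSpace.constant_plots x.2, rfl⟩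
      plot_reparam := by
        rintro n m p f ⟨i, q, hq, rfl⟩ hf
        exact ⟨i, q ∘ f, DiffeologicalSpace.plot_reparam hq hf, rfl⟩
      locality := by
        intro n p hp
        have hloc : IsLocallyConstant (fun u ↦ (p u).1) := by
          rw [IsLocallyConstant.iff_exists_open]
          intro x
          obtain ⟨u, hu, hxu, h⟩ := hp x
          obtain ⟨ε, hε, hεu⟩ := Metric.isOpen_iff.mp hu x hxu
          have himg : ∀ y, OpenPartialHomeomorph.univBall x ε y ∈ Metric.ball x ε := fun y ↦ by
            have := (OpenPartialHomeomorph.univBall x ε).map_source (x := y) (by simp)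
            rwa [OpenPartialHomeomorph.univBall_target x hε] at this
          obtain ⟨i, q, -, hpq⟩ := h (f := OpenPartialHomeomorph.univBall x ε)
            (fun y ↦ hεu (himg y)) OpenPartialHomeomorph.contDiff_univBall
          have hconst : ∀ y ∈ Metric.ball x ε, (p y).1 = i := fun y hy ↦ by
            have hy' : y ∈ (OpenPartialHomeomorph.univBall x ε).target := by
              rwa [OpenPartialHomeomorph.univBall_target x hε]
            have h1 := congrFun hpq ((OpenPartialHomeomorph.univBall x ε).symm y)
            simp only [Function.comp] at h1
            rw [(OpenPartialHomeomorph.univBall x ε).right_inv hy'] at h1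
            rw [h1]
          refine ⟨Metric.ball x ε, Metric.isOpen_ball, Metric.mem_ball_self hε, fun y hy ↦ ?_⟩
          rw [hconst y hy, hconst x (Metric.mem_ball_self hε)]
        have hfib : ∀ y, ∃ a : X (p 0).1, p y = ⟨(p 0).1, a⟩ := fun y ↦ by
          have h1 : (p y).1 = (p 0).1 := hloc.apply_eq_of_isPreconnected isPreconnected_univ
            (Set.mem_univ y) (Set.mem_univ 0)
          exact ⟨h1 ▸ (p y).2, by
            generalize (p 0).1 = j at h1
            subst h1
            rfl⟩
        choose q hq using hfib
        refine ⟨(p 0).1, q, DiffeologicalSpace.locality fun x ↦ ?_, funext hq⟩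
        obtain ⟨u, hu, hxu, h⟩ := hp x
        refine ⟨u, hu, hxu, fun {m f} hfu hf ↦ ?_⟩
        obtain ⟨i, r, hr, hpr⟩ := h hfu hf
        have hir : ∀ z, (⟨(p 0).1, q (f z)⟩ : Σ i, X i) = ⟨i, r z⟩ := fun z ↦ by
          rw [← hq]
          exact congrFun hpr z
        have hi : (p 0).1 = i := congrArg Sigma.fst (hir 0)
        generalize (p 0).1 = j at hi q hir
        subst hi
        have : q ∘ f = r := funext fun z ↦ eq_of_heq (Sigma.mk.inj (hir z)).2
        rw [this]
        exact hr }

/-- Spaces of smooth maps, with the functional diffeology. -/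
def exp (X Y : DiffSp) : DiffSp where
  carrier := Hom X Y
  str :=
    { plots n := {p | DSmooth (fun z : prod (euc n) X ↦ p z.1 z.2)}
      constant_plots := fun f n q hq ↦ f.smooth n _ (isPlot_prod.1 hq).2
      plot_reparam := fun {n m p f} hp hf l q hq ↦
        hp l (fun z ↦ ((f (q z).1, (q z).2) : prod (euc m) X)) (isPlot_prod.2
          ⟨isPlot_euc.2 (hf.comp (isPlot_euc.1 (isPlot_prod.1 hq).1)), (isPlot_prod.1 hq).2⟩)
      locality := fun {n p} hp l q hq ↦ DiffeologicalSpace.locality fun z ↦ by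
        obtain ⟨u, hu, hzu, h⟩ := hp (q z).1
        have hg := isPlot_euc.1 (isPlot_prod.1 hq).1
        refine ⟨_, hu.preimage hg.continuous, hzu, fun {m f} hfu hf ↦ ?_⟩
        exact h (f := fun w ↦ (q (f w)).1) hfu (hg.comp hf) m
          (fun w ↦ ((w, (q (f w)).2) : prod (euc m) X))
          (isPlot_prod.2 ⟨isPlot_id, DiffeologicalSpace.plot_reparam (isPlot_prod.1 hq).2 hf⟩) }

/-- Lists over `X`, as the disjoint union of all finite powers of `X`. -/
def list (X : DiffSp) : DiffSp := sigma fun m : ℕ ↦ pi fun _ : Fin m ↦ X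

end DiffSp

namespace Hom

variable {E X Y Z : DiffSp}

def id (X : DiffSp) : Hom X X := ⟨fun x ↦ x, fun _ _ hp ↦ hp⟩

def const (c : Y) : Hom X Y := ⟨fun _ ↦ c, fun _ _ _ ↦ DiffeologicalSpace.constant_plots c⟩

def comp (g : Hom Y Z) (f : Hom X Y) : Hom X Z :=
  ⟨fun x ↦ g (f x), fun n p hp ↦ g.smooth n _ (f.smooth n p hp)⟩

def toUnit : Hom X DiffSp.unit := ⟨fun _ ↦ (), fun _ _ _ ↦ DiffSp.isPlot_unit _⟩

def fst : Hom (DiffSp.prod X Y) X := ⟨fun z ↦ z.1, fun _ _ hp ↦ (DiffSp.isPlot_prod.1 hp).1⟩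

def snd : Hom (DiffSp.prod X Y) Y := ⟨fun z ↦ z.2, fun _ _ hp ↦ (DiffSp.isPlot_prod.1 hp).2⟩

def pair (f : Hom E X) (g : Hom E Y) : Hom E (DiffSp.prod X Y) :=
  ⟨fun e ↦ (f e, g e), fun n p hp ↦ DiffSp.isPlot_prod.2 ⟨f.smooth n p hp, g.smooth n p hp⟩⟩

def piProj {ι : Type} {X : ι → DiffSp} (i : ι) : Hom (DiffSp.pi X) (X i) :=
  ⟨fun x ↦ x i, fun _ _ hp ↦ DiffSp.isPlot_pi.1 hp i⟩

def piLift {ι : Type} {X : ι → DiffSp} (f : ∀ i, Hom E (X i)) : Hom E (DiffSp.pi X) :=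
  ⟨fun e i ↦ f i e, fun n p hp ↦ DiffSp.isPlot_pi.2 fun i ↦ (f i).smooth n p hp⟩

def inj {ι : Type} {X : ι → DiffSp} (i : ι) : Hom (X i) (DiffSp.sigma X) :=
  ⟨fun x ↦ ⟨i, x⟩, fun _ p hp ↦ ⟨i, p, hp, rfl⟩⟩

/-- Case distinction over a disjoint union, with parameters in `E`. -/
def case {ι : Type} {X : ι → DiffSp} (f : ∀ i, Hom (DiffSp.prod (X i) E) Y) :
    Hom (DiffSp.prod (DiffSp.sigma X) E) Y where
  toFun z := f z.1.1 (z.1.2, z.2)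
  smooth n p hp := by
    obtain ⟨⟨i, q, hq, hpq⟩, h2⟩ := DiffSp.isPlot_prod.1 hp
    have := (f i).smooth n (fun u ↦ (q u, (p u).2)) (DiffSp.isPlot_prod.2 ⟨hq, h2⟩)
    convert this using 1
    funext u
    have key : ∀ (s : DiffSp.sigma X) (e : E), s = ⟨i, q u⟩ → f s.1 (s.2, e) = f i (q u, e) := by
      rintro _ e rfl
      rfl
    exact key _ _ (congrFun hpq u)

def curry (f : Hom (DiffSp.prod X E) Y) : Hom E (DiffSp.exp X Y) where
  toFun e := ⟨fun x ↦ f (x, e), fun n p hp ↦ f.smooth n (fun u ↦ (p u, e))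
    (DiffSp.isPlot_prod.2 ⟨hp, DiffeologicalSpace.constant_plots e⟩)⟩
  smooth _ p hp m q hq := f.smooth m (fun z ↦ ((q z).2, p (q z).1))
    (DiffSp.isPlot_prod.2 ⟨(DiffSp.isPlot_prod.1 hq).2,
      DiffeologicalSpace.plot_reparam hp (DiffSp.isPlot_euc.1 (DiffSp.isPlot_prod.1 hq).1)⟩)

def app (f : Hom E (DiffSp.exp X Y)) (g : Hom E X) : Hom E Y where
  toFun e := (f e).toFun (g e)
  smooth n p hp := f.smooth n p hp n (fun u ↦ ((u, g (p u)) : DiffSp.prod (DiffSp.euc n) X))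
    (DiffSp.isPlot_prod.2 ⟨isPlot_id, g.smooth n p hp⟩)

def nil : Hom E (DiffSp.list X) := const ⟨0, fun i ↦ i.elim0⟩

def cons (f : Hom E X) (g : Hom E (DiffSp.list X)) : Hom E (DiffSp.list X) where
  toFun e := ⟨(g e).1 + 1, Fin.cons (f e) (g e).2⟩
  smooth n p hp := by
    obtain ⟨m, q, hq, hpq⟩ := g.smooth n p hp
    refine ⟨m + 1, fun u ↦ Fin.cons (f (p u)) (q u), DiffSp.isPlot_pi.2 fun i ↦ ?_, ?_⟩
    · refine Fin.cases ?_ (fun j ↦ ?_) i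
      · exact f.smooth n p hp
      · exact DiffSp.isPlot_pi.1 hq j
    · funext u
      have hu : g (p u) = ⟨m, q u⟩ := congrFun hpq u
      simp only [Function.comp]
      rw [hu]

/-- The right fold of a list `v` of length `m`, at the parameter `e`. -/
def foldAux (step : Hom (DiffSp.prod Y (DiffSp.prod X E)) Y) (init : Hom E Y) (e : E) :
    (m : ℕ) → (Fin m → X) → Y
  | 0, _ => init e
  | m + 1, v => step (foldAux step init e m (fun i ↦ v i.succ), (v 0, e))

theorem foldAux_smooth (step : Hom (DiffSp.prod Y (DiffSp.prod X E)) Y) (init : Hom E Y) {n : ℕ}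
    (p : EuclideanSpace ℝ (Fin n) → E) (hp : IsPlot p) (m : ℕ)
    (q : EuclideanSpace ℝ (Fin n) → Fin m → X) (hq : ∀ i, IsPlot (fun u ↦ q u i)) :
    IsPlot (fun u ↦ foldAux step init (p u) m (q u)) := by
  induction m with
  | zero => exact init.smooth n p hp
  | succ m ih =>
    exact step.smooth n _ (DiffSp.isPlot_prod.2
      ⟨ih (fun u i ↦ q u i.succ) (fun i ↦ hq i.succ), DiffSp.isPlot_prod.2 ⟨hq 0, hp⟩⟩)

def fold (step : Hom (DiffSp.prod Y (DiffSp.prod X E)) Y) (l : Hom E (DiffSp.list X))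
    (init : Hom E Y) : Hom E Y where
  toFun e := foldAux step init e (l e).1 (l e).2
  smooth n p hp := by
    obtain ⟨m, q, hq, hpq⟩ := l.smooth n p hp
    convert foldAux_smooth step init p hp m q (DiffSp.isPlot_pi.1 hq) using 1
    funext u
    have hu : l (p u) = ⟨m, q u⟩ := congrFun hpq u
    simp only [Function.comp]
    rw [hu]

def ofContDiff (f : ℝ → ℝ) (hf : ContDiff ℝ ∞ f) : Hom DiffSp.real DiffSp.real :=
  ⟨f, fun _ _ hp ↦ DiffSp.isPlot_real.2 (hf.comp (DiffSp.isPlot_real.1 hp))⟩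

def add (f g : Hom E DiffSp.real) : Hom E DiffSp.real :=
  ⟨fun e ↦ HAdd.hAdd (α := ℝ) (β := ℝ) (f e) (g e), fun n p hp ↦ DiffSp.isPlot_real.2
    ((DiffSp.isPlot_real.1 (f.smooth n p hp)).add (DiffSp.isPlot_real.1 (g.smooth n p hp)))⟩

def mul (f g : Hom E DiffSp.real) : Hom E DiffSp.real :=
  ⟨fun e ↦ HMul.hMul (α := ℝ) (β := ℝ) (f e) (g e), fun n p hp ↦ DiffSp.isPlot_real.2
    ((DiffSp.isPlot_real.1 (f.smooth n p hp)).mul (DiffSp.isPlot_real.1 (g.smooth n p hp)))⟩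

/-- The sigmoid function `x ↦ 1 / (1 + e⁻ˣ)`. -/
def sigmoid : Hom DiffSp.real DiffSp.real :=
  ofContDiff (fun x ↦ 1 / (1 + Real.exp (-x))) (by
    refine contDiff_const.div (contDiff_const.add (Real.contDiff_exp.comp contDiff_neg)) ?_
    intro x
    positivity)

end Hom

/-! ## The language -/

/-- Types: reals, finite products, functions, finite variants (the constructors of a variant are
numbered by `Fin n`), and lists. -/
inductive Ty : Type
  | real : Ty
  | prod (n : ℕ) (σ : Fin n → Ty) : Ty
  | fn (σ τ : Ty) : Ty
  | variant (n : ℕ) (σ : Fin n → Ty) : Ty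
  | list (σ : Ty) : Ty

namespace Ty

/-- Binary products. -/
def pair (σ τ : Ty) : Ty := prod 2 ![σ, τ]

/-- The type `realᵏ`. -/
def vec (k : ℕ) : Ty := prod k fun _ ↦ real

/-- First order types: those built without function types. -/
def FirstOrder : Ty → Prop
  | real => True
  | prod _ σ => ∀ i, (σ i).FirstOrder
  | fn _ _ => False
  | variant _ σ => ∀ i, (σ i).FirstOrder
  | list σ => σ.FirstOrder

/-- The forward translation of types with `k` tangents. -/
def D (k : ℕ) : Ty → Ty
  | real => pair real (vec k)
  | prod n σ => prod n fun i ↦ (σ i).D k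
  | fn σ τ => fn (σ.D k) (τ.D k)
  | variant n σ => variant n fun i ↦ (σ i).D k
  | list σ => list (σ.D k)

/-- The continuation-based translation of types, with answer type `realᵏ`. -/
def Drev (k : ℕ) : Ty → Ty
  | real => pair real (fn real (vec k))
  | prod n σ => prod n fun i ↦ (σ i).Drev k
  | fn σ τ => fn (σ.Drev k) (τ.Drev k)
  | variant n σ => variant n fun i ↦ (σ i).Drev k
  | list σ => list (σ.Drev k)

end Ty

/-- Contexts: lists of the types of the variables, the most recently bound variable first. -/
abbrev Ctx := List Ty

/-- A context is first order if all its types are. -/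
def Ctx.FirstOrder (Γ : Ctx) : Prop := ∀ τ ∈ Γ, τ.FirstOrder

/-- `Γ` extended by `n` variables of types `σ 0, …, σ (n - 1)`. -/
def Ctx.ext (Γ : Ctx) : (n : ℕ) → (Fin n → Ty) → Ctx
  | 0, _ => Γ
  | n + 1, σ => σ 0 :: Ctx.ext Γ n fun i ↦ σ i.succ

theorem Ctx.map_ext (f : Ty → Ty) (Γ : Ctx) (n : ℕ) (σ : Fin n → Ty) :
    List.map f (Ctx.ext Γ n σ) = Ctx.ext (List.map f Γ) n fun i ↦ f (σ i) := by
  induction n with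
  | zero => rfl
  | succ n ih => simp only [Ctx.ext, List.map_cons, ih]

/-- Variables of type `τ` in a context, as de Bruijn indices. -/
inductive Var : Ctx → Ty → Type
  | z {Γ : Ctx} {τ : Ty} : Var (τ :: Γ) τ
  | s {Γ : Ctx} {σ τ : Ty} (x : Var Γ τ) : Var (σ :: Γ) τ

namespace Var

/-- The `i`-th of the `n` variables bound in `Γ.ext n σ`. -/
def bound {Γ : Ctx} : (n : ℕ) → (σ : Fin n → Ty) → (i : Fin n) → Var (Γ.ext n σ) (σ i)
  | 0, _ => fun i ↦ i.elim0
  | n + 1, σ => Fin.cases z fun i ↦ s (bound n (fun i ↦ σ i.succ) i)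

/-- A variable of `Γ`, seen in `Γ.ext n σ`. -/
def weaken {Γ : Ctx} {τ : Ty} : (n : ℕ) → (σ : Fin n → Ty) → Var Γ τ → Var (Γ.ext n σ) τ
  | 0, _, x => x
  | n + 1, σ, x => s (weaken n (fun i ↦ σ i.succ) x)

/-- The variable at the same position of the context translated by `f`. -/
def map (f : Ty → Ty) {Γ : Ctx} {τ : Ty} : Var Γ τ → Var (List.map f Γ) (f τ)
  | z => z
  | s x => s (x.map f)

end Var

/-- Well-typed terms `Γ ⊢ t : τ`.
* `letTuple t u` is the pattern match `case t of ⟨x₁, …, xₙ⟩ → u`;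
* `case t u` is the match `case t of {C₁ x₁ → u₁ | ⋯ | Cₙ xₙ → uₙ}`;
* `fold t u v` is `fold (x₁, x₂). t over u from v`, where in `t` the variable `x₁` (of index one)
  is the head of the list and `x₂` (of index zero) is the result for its tail. -/
inductive Tm : Ctx → Ty → Type
  | var {Γ : Ctx} {τ : Ty} (x : Var Γ τ) : Tm Γ τ
  | cst {Γ : Ctx} (c : ℝ) : Tm Γ Ty.real
  | add {Γ : Ctx} (t u : Tm Γ Ty.real) : Tm Γ Ty.real
  | mul {Γ : Ctx} (t u : Tm Γ Ty.real) : Tm Γ Ty.real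
  | sigmoid {Γ : Ctx} (t : Tm Γ Ty.real) : Tm Γ Ty.real
  | tuple {Γ : Ctx} {n : ℕ} {σ : Fin n → Ty} (t : ∀ i, Tm Γ (σ i)) : Tm Γ (Ty.prod n σ)
  | letTuple {Γ : Ctx} {n : ℕ} {σ : Fin n → Ty} {τ : Ty} (t : Tm Γ (Ty.prod n σ))
      (u : Tm (Γ.ext n σ) τ) : Tm Γ τ
  | lam {Γ : Ctx} {σ τ : Ty} (t : Tm (σ :: Γ) τ) : Tm Γ (Ty.fn σ τ)
  | app {Γ : Ctx} {σ τ : Ty} (t : Tm Γ (Ty.fn σ τ)) (u : Tm Γ σ) : Tm Γ τ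
  | inj {Γ : Ctx} {n : ℕ} {σ : Fin n → Ty} (i : Fin n) (t : Tm Γ (σ i)) : Tm Γ (Ty.variant n σ)
  | case {Γ : Ctx} {n : ℕ} {σ : Fin n → Ty} {τ : Ty} (t : Tm Γ (Ty.variant n σ))
      (u : ∀ i, Tm (σ i :: Γ) τ) : Tm Γ τ
  | nil {Γ : Ctx} {σ : Ty} : Tm Γ (Ty.list σ)
  | cons {Γ : Ctx} {σ : Ty} (t : Tm Γ σ) (u : Tm Γ (Ty.list σ)) : Tm Γ (Ty.list σ)
  | fold {Γ : Ctx} {σ τ : Ty} (t : Tm (τ :: σ :: Γ) τ) (u : Tm Γ (Ty.list σ)) (v : Tm Γ τ) :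
      Tm Γ τ

/-! ### Renaming and substitution -/

/-- Renamings of the variables of `Γ` by variables of `Δ`. -/
def Ren (Γ Δ : Ctx) : Type := ∀ ⦃τ : Ty⦄, Var Γ τ → Var Δ τ

def Ren.lift {Γ Δ : Ctx} (r : Ren Γ Δ) (σ : Ty) : Ren (σ :: Γ) (σ :: Δ)
  | _, .z => .z
  | _, .s x => .s (r x)

def Ren.liftN {Γ Δ : Ctx} (r : Ren Γ Δ) : (n : ℕ) → (σ : Fin n → Ty) →
    Ren (Γ.ext n σ) (Δ.ext n σ)
  | 0, _ => r
  | n + 1, σ => Ren.lift (r.liftN n fun i ↦ σ i.succ) (σ 0)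

def Tm.rename : {Γ : Ctx} → {τ : Ty} → Tm Γ τ → {Δ : Ctx} → Ren Γ Δ → Tm Δ τ
  | _, _, .var x, _, r => .var (r x)
  | _, _, .cst c, _, _ => .cst c
  | _, _, .add t u, _, r => .add (t.rename r) (u.rename r)
  | _, _, .mul t u, _, r => .mul (t.rename r) (u.rename r)
  | _, _, .sigmoid t, _, r => .sigmoid (t.rename r)
  | _, _, .tuple t, _, r => .tuple fun i ↦ (t i).rename r
  | _, _, .letTuple t u, _, r => .letTuple (t.rename r) (u.rename (r.liftN _ _))
  | _, _, .lam t, _, r => .lam (t.rename (r.lift _))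
  | _, _, .app t u, _, r => .app (t.rename r) (u.rename r)
  | _, _, .inj i t, _, r => .inj i (t.rename r)
  | _, _, .case t u, _, r => .case (t.rename r) fun i ↦ (u i).rename (r.lift _)
  | _, _, .nil, _, _ => .nil
  | _, _, .cons t u, _, r => .cons (t.rename r) (u.rename r)
  | _, _, .fold t u v, _, r => .fold (t.rename ((r.lift _).lift _)) (u.rename r) (v.rename r)

/-- Weakening by one variable. -/
def Tm.wk {Γ : Ctx} {σ τ : Ty} (t : Tm Γ τ) : Tm (σ :: Γ) τ := t.rename fun _ x ↦ .s x

/-- Weakening by `n` variables. -/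
def Tm.wkN {Γ : Ctx} {τ : Ty} (t : Tm Γ τ) (n : ℕ) (σ : Fin n → Ty) : Tm (Γ.ext n σ) τ :=
  t.rename fun _ x ↦ x.weaken n σ

/-- Simultaneous substitutions for the variables of `Γ` by terms over `Δ`. -/
def Sub (Γ Δ : Ctx) : Type := ∀ ⦃τ : Ty⦄, Var Γ τ → Tm Δ τ

def Sub.lift {Γ Δ : Ctx} (θ : Sub Γ Δ) (σ : Ty) : Sub (σ :: Γ) (σ :: Δ)
  | _, .z => .var .z
  | _, .s x => (θ x).wk

def Sub.liftN {Γ Δ : Ctx} (θ : Sub Γ Δ) : (n : ℕ) → (σ : Fin n → Ty) →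
    Sub (Γ.ext n σ) (Δ.ext n σ)
  | 0, _ => θ
  | n + 1, σ => Sub.lift (θ.liftN n fun i ↦ σ i.succ) (σ 0)

def Tm.subst : {Γ : Ctx} → {τ : Ty} → Tm Γ τ → {Δ : Ctx} → Sub Γ Δ → Tm Δ τ
  | _, _, .var x, _, θ => θ x
  | _, _, .cst c, _, _ => .cst c
  | _, _, .add t u, _, θ => .add (t.subst θ) (u.subst θ)
  | _, _, .mul t u, _, θ => .mul (t.subst θ) (u.subst θ)
  | _, _, .sigmoid t, _, θ => .sigmoid (t.subst θ)
  | _, _, .tuple t, _, θ => .tuple fun i ↦ (t i).subst θ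
  | _, _, .letTuple t u, _, θ => .letTuple (t.subst θ) (u.subst (θ.liftN _ _))
  | _, _, .lam t, _, θ => .lam (t.subst (θ.lift _))
  | _, _, .app t u, _, θ => .app (t.subst θ) (u.subst θ)
  | _, _, .inj i t, _, θ => .inj i (t.subst θ)
  | _, _, .case t u, _, θ => .case (t.subst θ) fun i ↦ (u i).subst (θ.lift _)
  | _, _, .nil, _, _ => .nil
  | _, _, .cons t u, _, θ => .cons (t.subst θ) (u.subst θ)
  | _, _, .fold t u v, _, θ => .fold (t.subst ((θ.lift _).lift _)) (u.subst θ) (v.subst θ)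

/-! ### Syntactic sugar -/

namespace Tm

/-- Pairs `⟨t, u⟩`. -/
def pair {Γ : Ctx} {σ τ : Ty} (t : Tm Γ σ) (u : Tm Γ τ) : Tm Γ (Ty.pair σ τ) :=
  .tuple (σ := ![σ, τ]) (Fin.cases t (Fin.cases u fun i ↦ i.elim0))

/-- `case t of ⟨x, y⟩ → u`; in `u`, the variable `x` has index zero and `y` has index one. -/
def letPair {Γ : Ctx} {σ σ' τ : Ty} (t : Tm Γ (Ty.pair σ σ')) (u : Tm (σ :: σ' :: Γ) τ) :
    Tm Γ τ :=
  .letTuple (σ := ![σ, σ']) t u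

/-- `let x = t in u`. -/
def letIn {Γ : Ctx} {σ τ : Ty} (t : Tm Γ σ) (u : Tm (σ :: Γ) τ) : Tm Γ τ := .app (.lam u) t

/-- `t - u`, that is `t + (-1) * u`. -/
def sub {Γ : Ctx} (t u : Tm Γ Ty.real) : Tm Γ Ty.real := .add t (.mul (.cst (-1)) u)

/-- Addition of vectors: `case t of ⟨x₁, …, xₖ⟩ → case u of ⟨y₁, …, yₖ⟩ → ⟨x₁ + y₁, …, xₖ + yₖ⟩`. -/
def addVec {Γ : Ctx} {k : ℕ} (t u : Tm Γ (Ty.vec k)) : Tm Γ (Ty.vec k) :=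
  .letTuple t <| .letTuple (u.wkN k _) <|
    .tuple fun i ↦ .add (.var ((Var.bound k _ i).weaken k _)) (.var (Var.bound k _ i))

/-- Transport of a term along an equality of contexts. -/
def castCtx {Γ Δ : Ctx} {τ : Ty} (h : Γ = Δ) (t : Tm Γ τ) : Tm Δ τ := h ▸ t

/-- The variable of index zero, one, two, three. -/
def v0 {Γ : Ctx} {a : Ty} : Tm (a :: Γ) a := .var .z
def v1 {Γ : Ctx} {a b : Ty} : Tm (b :: a :: Γ) a := .var (.s .z)
def v2 {Γ : Ctx} {a b c : Ty} : Tm (c :: b :: a :: Γ) a := .var (.s (.s .z))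
def v3 {Γ : Ctx} {a b c d : Ty} : Tm (d :: c :: b :: a :: Γ) a := .var (.s (.s (.s .z)))
def v4 {Γ : Ctx} {a b c d e : Ty} : Tm (e :: d :: c :: b :: a :: Γ) a :=
  .var (.s (.s (.s (.s .z))))

/-! ### The continuation-based translation of terms -/

/-- `⟨c, λ z. ⟨0, …, 0⟩⟩`. -/
def cstRev (k : ℕ) {Γ : Ctx} (c : ℝ) : Tm Γ (Ty.real.Drev k) :=
  pair (.cst c) (.lam (.tuple fun _ ↦ .cst 0))

/-- `case t of ⟨x, x'⟩ → case u of ⟨y, y'⟩ → ⟨x + y, λ z. x' z + y' z⟩`.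
Under the innermost binder the indices are `z = 0`, `y = 1`, `y' = 2`, `x = 3`, `x' = 4`. -/
def addRev (k : ℕ) {Γ : Ctx} (t u : Tm Γ (Ty.real.Drev k)) : Tm Γ (Ty.real.Drev k) :=
  letPair t <| letPair u.wk.wk <|
    pair (.add v2 v0) (.lam (addVec (.app v4 v0) (.app v2 v0)))

/-- `case t of ⟨x, x'⟩ → case u of ⟨y, y'⟩ → ⟨x * y, λ z. x' (y * z) + y' (x * z)⟩`. -/
def mulRev (k : ℕ) {Γ : Ctx} (t u : Tm Γ (Ty.real.Drev k)) : Tm Γ (Ty.real.Drev k) :=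
  letPair t <| letPair u.wk.wk <|
    pair (.mul v2 v0) (.lam (addVec (.app v4 (.mul v1 v0)) (.app v2 (.mul v3 v0))))

/-- `case t of ⟨x, x'⟩ → let y = ς(x) in ⟨y, λ z. x' (y * (1 - y) * z)⟩`.
Under the innermost binder the indices are `z = 0`, `y = 1`, `x = 2`, `x' = 3`. -/
def sigmoidRev (k : ℕ) {Γ : Ctx} (t : Tm Γ (Ty.real.Drev k)) : Tm Γ (Ty.real.Drev k) :=
  letPair t <| letIn (.sigmoid v0) <|
    pair v0 (.lam (.app v3 (.mul (.mul v1 (sub (.cst 1) v1)) v0)))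

/-- The continuation-based translation of terms. It preserves all type and term formers other than
the reals and their operations. -/
def Drev (k : ℕ) : {Γ : Ctx} → {τ : Ty} → Tm Γ τ → Tm (List.map (Ty.Drev k) Γ) (τ.Drev k)
  | _, _, .var x => .var (x.map (Ty.Drev k))
  | _, _, .cst c => cstRev k c
  | _, _, .add t u => addRev k (t.Drev k) (u.Drev k)
  | _, _, .mul t u => mulRev k (t.Drev k) (u.Drev k)
  | _, _, .sigmoid t => sigmoidRev k (t.Drev k)
  | _, _, .tuple t => .tuple fun i ↦ (t i).Drev k
  | _, _, .letTuple t u => .letTuple (t.Drev k) (castCtx (Ctx.map_ext _ _ _ _) (u.Drev k))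
  | _, _, .lam t => .lam (t.Drev k)
  | _, _, .app t u => .app (t.Drev k) (u.Drev k)
  | _, _, .inj i t => .inj i (t.Drev k)
  | _, _, .case t u => .case (t.Drev k) fun i ↦ (u i).Drev k
  | _, _, .nil => .nil
  | _, _, .cons t u => .cons (t.Drev k) (u.Drev k)
  | _, _, .fold t u v => .fold (t.Drev k) (u.Drev k) (v.Drev k)

/-- The terms `lamR_τ : D τ → Drev τ` for first order `τ`, encoding tangent vectors as closures:
at the reals, `λ z. case z of ⟨x, x'⟩ → case x' of ⟨x'₁, …, x'ₖ⟩ → ⟨x, λ y. ⟨x'₁ * y, …, x'ₖ * y⟩⟩`,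
and componentwise at the other types. -/
def lamR (k : ℕ) {Γ : Ctx} : (τ : Ty) → τ.FirstOrder → Tm Γ (Ty.fn (τ.D k) (τ.Drev k))
  | .real, _ => .lam <| letPair v0 <| .letTuple (σ := fun _ : Fin k ↦ Ty.real) v1 <|
      pair (v0.wkN k _) (.lam (.tuple fun i ↦ .mul (.var (.s (.bound k _ i))) v0))
  | .prod n _, h => .lam <| .letTuple v0 <|
      .tuple fun i ↦ .app (lamR k _ (h i)) (.var (.bound n _ i))
  | .fn _ _, h => h.elim
  | .variant _ _, h => .lam <| .case v0 fun i ↦ .inj i (.app (lamR k _ (h i)) v0)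
  | .list σ, h => .lam <| .fold (.cons (.app (lamR k σ h) v1) v0) v0 .nil

/-- The terms `evR_τ : Drev τ → D τ` for first order `τ`, evaluating the closures: at the reals,
`λ z. case z of ⟨x, x'⟩ → ⟨x, x' 1⟩`, and componentwise at the other types. -/
def evR (k : ℕ) {Γ : Ctx} : (τ : Ty) → τ.FirstOrder → Tm Γ (Ty.fn (τ.Drev k) (τ.D k))
  | .real, _ => .lam <| letPair v0 <| pair v0 (.app v1 (.cst 1))
  | .prod n _, h => .lam <| .letTuple v0 <|
      .tuple fun i ↦ .app (evR k _ (h i)) (.var (.bound n _ i))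
  | .fn _ _, h => h.elim
  | .variant _ _, h => .lam <| .case v0 fun i ↦ .inj i (.app (evR k _ (h i)) v0)
  | .list σ, h => .lam <| .fold (.cons (.app (evR k σ h) v1) v0) v0 .nil

end Tm

/-- `lamR` for a first order context: each variable `x : Drev τ` is replaced by `lamR_τ x`, where
now `x : D τ`. -/
def Sub.lamR (k : ℕ) : (Γ : Ctx) → Γ.FirstOrder →
    Sub (List.map (Ty.Drev k) Γ) (List.map (Ty.D k) Γ)
  | [], _ => fun _ x ↦ nomatch x
  | σ :: Γ, h => fun _ x ↦ match x with
    | .z => .app (Tm.lamR k σ (h σ (by simp))) Tm.v0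
    | .s x => (Sub.lamR k Γ (fun τ hτ ↦ h τ (by simp [hτ])) x).wk

/-- The composite `lamR_Γ ; Drev t ; evR_τ`, that is the term `evR_τ ((Drev t)[lamR_Γ])`. -/
def Tm.revAD (k : ℕ) {Γ : Ctx} {τ : Ty} (hΓ : Γ.FirstOrder) (hτ : τ.FirstOrder) (t : Tm Γ τ) :
    Tm (List.map (Ty.D k) Γ) (τ.D k) :=
  .app (Tm.evR k τ hτ) ((t.Drev k).subst (Sub.lamR k Γ hΓ))

/-! ### Denotational semantics -/

/-- The diffeological space denoted by a type. -/
def Ty.sem : Ty → DiffSp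
  | .real => DiffSp.real
  | .prod _ σ => DiffSp.pi fun i ↦ (σ i).sem
  | .fn σ τ => DiffSp.exp σ.sem τ.sem
  | .variant _ σ => DiffSp.sigma fun i ↦ (σ i).sem
  | .list σ => DiffSp.list σ.sem

/-- The diffeological space denoted by a context: the product of the spaces of its variables. -/
def Ctx.sem : Ctx → DiffSp
  | [] => DiffSp.unit
  | τ :: Γ => DiffSp.prod τ.sem (Ctx.sem Γ)

def Var.sem : {Γ : Ctx} → {τ : Ty} → Var Γ τ → Hom Γ.sem τ.sem
  | _, _, .z => Hom.fst
  | _, _, .s x => Hom.comp x.sem Hom.snd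

/-- The extension of a valuation of `Γ` by the components of a tuple. -/
def Ctx.semExt {E : DiffSp} {Γ : Ctx} (ρ : Hom E Γ.sem) : (n : ℕ) → (σ : Fin n → Ty) →
    (∀ i, Hom E (σ i).sem) → Hom E (Γ.ext n σ).sem
  | 0, _, _ => ρ
  | n + 1, σ, a => Hom.pair (a 0) (Ctx.semExt ρ n (fun i ↦ σ i.succ) fun i ↦ a i.succ)

/-- The smooth map denoted by a term. -/
def Tm.sem : {Γ : Ctx} → {τ : Ty} → Tm Γ τ → Hom Γ.sem τ.sem
  | _, _, .var x => x.sem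
  | _, _, .cst c => Hom.const (Y := DiffSp.real) c
  | _, _, .add t u => Hom.add t.sem u.sem
  | _, _, .mul t u => Hom.mul t.sem u.sem
  | _, _, .sigmoid t => Hom.comp Hom.sigmoid t.sem
  | _, _, .tuple t => Hom.piLift fun i ↦ (t i).sem
  | Γ, _, .letTuple (n := n) (σ := σ) t u => Hom.comp u.sem
      (Ctx.semExt (Hom.id Γ.sem) n σ
        fun i ↦ Hom.comp (Hom.piProj (X := fun i ↦ (σ i).sem) i) t.sem)
  | _, _, .lam t => Hom.curry t.sem
  | _, _, .app t u => Hom.app t.sem u.sem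
  | _, _, .inj (σ := σ) i t => Hom.comp (Hom.inj (X := fun i ↦ (σ i).sem) i) t.sem
  | Γ, _, .case t u => Hom.comp (Hom.case fun i ↦ (u i).sem) (Hom.pair t.sem (Hom.id Γ.sem))
  | _, _, .nil => Hom.nil
  | _, _, .cons t u => Hom.cons t.sem u.sem
  | _, _, .fold t u v => Hom.fold t.sem u.sem v.sem

/-! ## Tangent bundles -/

/-- Smooth curves in `X` based at `x`. -/
def Curve (X : DiffSp) (x : X) : Type := {γ : Hom DiffSp.real X // γ (0 : ℝ) = x}

/-- Two curves based at `x` are tangent if all smooth functions have the same derivative along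
them at time zero. -/
instance Curve.setoid (X : DiffSp) (x : X) : Setoid (Curve X x) where
  r γ₁ γ₂ := ∀ f : Hom X DiffSp.real,
    deriv (F := ℝ) (fun t : ℝ ↦ f (γ₁.1 t)) 0 = deriv (F := ℝ) (fun t : ℝ ↦ f (γ₂.1 t)) 0
  iseqv := ⟨fun _ _ ↦ rfl, fun h f ↦ (h f).symm, fun h h' f ↦ (h f).trans (h' f)⟩

/-- The tangent space of `X` at `x`. -/
def TangentSp (X : DiffSp) (x : X) : Type := Quotient (Curve.setoid X x)

/-- The tangent vector of a smooth curve at time zero. -/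
def velocity {X : DiffSp} (γ : Hom DiffSp.real X) : TangentSp X (γ (0 : ℝ)) :=
  Quotient.mk _ ⟨γ, rfl⟩

/-- The derivative of a smooth map at a point. -/
def TangentSp.map {X Y : DiffSp} (f : Hom X Y) (x : X) : TangentSp X x → TangentSp Y (f x) :=
  Quotient.map (fun γ ↦ ⟨Hom.comp f γ.1, congrArg f.toFun γ.2⟩)
    fun _ _ (h : (Curve.setoid X x).r _ _) g ↦ h (Hom.comp g f)

/-- The tangent bundle. Its diffeology is generated by the smooth families of tangent vectors
`u ↦ (F (u, 0), [t ↦ F (u, t)])`, where `F : ℝⁿ × ℝ → X` is smooth; if `X` is a manifold, then this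
is the diffeology of the usual manifold structure on the tangent bundle. -/
def DiffSp.tangent (X : DiffSp) : DiffSp where
  carrier := Σ x : X, TangentSp X x
  str := DiffeologicalSpace.generateFrom
    {p | ∃ F : Hom (DiffSp.prod (DiffSp.euc p.1) DiffSp.real) X,
      ∀ u : DiffSp.euc p.1, p.2 u =
        ⟨F (u, (0 : ℝ)), velocity (Hom.comp F (Hom.pair (Hom.const u) (Hom.id DiffSp.real)))⟩}

/-- The `k`-fold fibre product of the tangent bundle over `X`: its points are the points of `X`
with `k` tangent vectors, and it has the coarsest diffeology for which the projections to `X` and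
to the tangent bundle are smooth. -/
def DiffSp.tangentPow (k : ℕ) (X : DiffSp) : DiffSp where
  carrier := Σ x : X, (Fin k → TangentSp X x)
  str := induced (fun v ↦ v.1) X.str ⊓
    ⨅ j : Fin k, induced (fun v ↦ (⟨v.1, v.2 j⟩ : X.tangent)) X.tangent.str

/-- The action of the `k`-fold tangent functor on smooth maps. -/
def tangentMap (k : ℕ) {X Y : DiffSp} (f : Hom X Y) (v : X.tangentPow k) : Y.tangentPow k :=
  ⟨f v.1, fun j ↦ TangentSp.map f v.1 (v.2 j)⟩

/-! ### The canonical isomorphisms -/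

/-- The canonical map `∏ᵢ Tᵏ Xᵢ → Tᵏ (∏ᵢ Xᵢ)`, inverse to the map whose components are the
`Tᵏ`-images of the projections: a family of tangent vectors, represented by curves, goes to the
tangent vector of the tuple of these curves. -/
def tangentPi (k : ℕ) {ι : Type} {X : ι → DiffSp} (v : ∀ i, (X i).tangentPow k) :
    (DiffSp.pi X).tangentPow k :=
  ⟨fun i ↦ (v i).1, fun j ↦ Quotient.mk _
    ⟨Hom.piLift fun i ↦ ((v i).2 j).out.1, funext fun i ↦ ((v i).2 j).out.2⟩⟩

/-- The canonical map `Tᵏ X × Tᵏ Y → Tᵏ (X × Y)`. -/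
def tangentProd (k : ℕ) {X Y : DiffSp} (v : X.tangentPow k) (w : Y.tangentPow k) :
    (DiffSp.prod X Y).tangentPow k :=
  ⟨(v.1, w.1), fun j ↦ Quotient.mk _
    ⟨Hom.pair (v.2 j).out.1 (w.2 j).out.1, Prod.ext (v.2 j).out.2 (w.2 j).out.2⟩⟩

theorem tangentMap_tangentPi (k : ℕ) {ι : Type} {X : ι → DiffSp}
    (v : ∀ i, (X i).tangentPow k) (i : ι) :
    tangentMap k (Hom.piProj i) (tangentPi k v) = v i :=
  Sigma.ext rfl (heq_of_eq (funext fun j ↦ ((v i).2 j).out_eq))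

/-- The smooth curve `t ↦ a + b t` in the reals. -/
def line (a b : ℝ) : Hom DiffSp.real DiffSp.real :=
  Hom.ofContDiff (fun t ↦ a + b * t) (contDiff_const.add (contDiff_const.mul contDiff_id))

/-- The canonical map `ℝ × ℝᵏ → Tᵏ ℝ`, sending `(x, x')` to `(x, [t ↦ x + x'ⱼ t]ⱼ)`. -/
def tangentReal (k : ℕ) (x : ℝ) (x' : Fin k → ℝ) : DiffSp.real.tangentPow k :=
  ⟨x, fun j ↦ Quotient.mk _ ⟨line x (x' j), show x + x' j * 0 = x by simp⟩⟩

/-- The canonical isomorphism `⟦D τ⟧ → Tᵏ ⟦τ⟧` for a first order type `τ`. -/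
def Ty.toTangent (k : ℕ) : (τ : Ty) → τ.FirstOrder → (τ.D k).sem → τ.sem.tangentPow k
  | .real, _ => fun d ↦ tangentReal k (d (0 : Fin 2)) (d (1 : Fin 2))
  | .prod _ σ, h => fun d ↦ tangentPi k fun i ↦ (σ i).toTangent k (h i) (d i)
  | .fn _ _, h => h.elim
  | .variant _ σ, h => fun d ↦
      tangentMap k (Hom.inj (X := fun i ↦ (σ i).sem) d.1) ((σ d.1).toTangent k (h d.1) d.2)
  | .list σ, h => fun d ↦
      tangentMap k (Hom.inj (X := fun m : ℕ ↦ DiffSp.pi fun _ : Fin m ↦ σ.sem) d.1)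
        (tangentPi k fun i ↦ σ.toTangent k h (d.2 i))

/-- The canonical isomorphism `⟦D Γ⟧ → Tᵏ ⟦Γ⟧` for a first order context `Γ`. -/
def Ctx.toTangent (k : ℕ) : (Γ : Ctx) → Γ.FirstOrder →
    Ctx.sem (List.map (Ty.D k) Γ) → (Ctx.sem Γ).tangentPow k
  | [], _ => fun _ ↦ ⟨(), fun _ ↦ Quotient.mk _ ⟨Hom.toUnit, rfl⟩⟩
  | σ :: Γ, h => fun d ↦ tangentProd k (σ.toTangent k (h σ (by simp)) d.1)
      (Ctx.toTangent k Γ (fun τ hτ ↦ h τ (by simp [hτ])) d.2)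

/-- Isomorphisms of diffeological spaces. -/
def IsDiffeo {X Y : DiffSp} (f : X → Y) : Prop :=
  DSmooth f ∧ ∃ g : Y → X, DSmooth g ∧ Function.LeftInverse g f ∧ Function.RightInverse g f

end RevAD

end

open Diffeology
open scoped ContDiff

noncomputable section

namespace RevAD

/-! A direct induction on `t` is impossible, since subterms may have function types, where no
comparison with a tangent bundle is available. It is replaced by a logical relation `Ty.Rel` between
a smooth curve in `⟦τ⟧` and a single point of `⟦Drev τ⟧`. At the reals the point must have the value
of the curve at time zero as its primal part and `z ↦ z * γ'(0)` as one coordinate of its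
backpropagator; at function types related arguments must give related results. A curve carries one
velocity whereas a point carries `k` of them, so the relation looks at one coordinate `j` at a time.
The index `none` ignores all coordinates and controls base points only.

The fundamental lemma `Tm.rel` says that every term preserves the relation; only the operations on
reals need calculus (sum, product and chain rule). At first order types the relation is tied to
tangent vectors by `Represents`: `lamR` turns a vector represented by a curve into a related point
(`Represents.rel_lamR`), and `evR` turns a related point into a vector represented by that curve
(`Ty.Rel.represents_evR`). Hence if `γ` represents the `j`-th input vector, then `⟦t⟧ ∘ γ`
represents the `j`-th output vector, and its velocity is by definition the image of that of `γ`
under the tangent map.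

That the canonical maps are diffeomorphisms follows by induction on types, once the tangent functor
is known to commute with finite products and disjoint unions and to be `ℝ × ℝᵏ` at the reals.
Smoothness is accessible because plots of the tangent bundle are locally families of curves
(`isLocalCurveFamily_of_isPlot`). The other inputs are that a velocity in a finite product is
determined by its components (`curveTangent_pi_ext`), that test functions on a summand extend by
zero (`tangentBundleMap_inj_injective`), and that time derivatives of smooth families are smooth
(`contDiff_deriv₀`). -/

/-! ## Semantics of renaming and substitution -/

/-- The extension of a point of `⟦Γ⟧` by the components of a tuple. -/
def Ctx.extend {Γ : Ctx} (d : Γ.sem) : (n : ℕ) → (σ : Fin n → Ty) →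
    (∀ i, (σ i).sem) → (Γ.ext n σ).sem
  | 0, _, _ => d
  | n + 1, σ, a => (a 0, Ctx.extend d n (fun i ↦ σ i.succ) fun i ↦ a i.succ)

theorem Ctx.semExt_apply {E : DiffSp} {Γ : Ctx} (ρ : Hom E Γ.sem) (n : ℕ) (σ : Fin n → Ty)
    (a : ∀ i, Hom E (σ i).sem) (e : E) :
    Ctx.semExt ρ n σ a e = Ctx.extend (ρ e) n σ fun i ↦ a i e := by
  induction n with
  | zero => rfl
  | succ n ih => exact congrArg (Prod.mk (a 0 e)) (ih _ _)

theorem Var.sem_bound_extend {Γ : Ctx} (d : Γ.sem) (n : ℕ) (σ : Fin n → Ty)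
    (a : ∀ i, (σ i).sem) (i : Fin n) :
    (Var.bound (Γ := Γ) n σ i).sem (Ctx.extend d n σ a) = a i := by
  induction n with
  | zero => exact i.elim0
  | succ n ih =>
    refine Fin.cases rfl (fun j ↦ ?_) i
    exact ih (fun i ↦ σ i.succ) (fun i ↦ a i.succ) j

theorem Var.sem_weaken_extend {Γ : Ctx} {τ : Ty} (d : Γ.sem) (n : ℕ) (σ : Fin n → Ty)
    (a : ∀ i, (σ i).sem) (x : Var Γ τ) :
    (Var.weaken n σ x).sem (Ctx.extend d n σ a) = x.sem d := by
  induction n with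
  | zero => rfl
  | succ n ih => exact ih (fun i ↦ σ i.succ) (fun i ↦ a i.succ)

theorem Hom.foldAux_congr {E E' X Y : DiffSp} {step : Hom (DiffSp.prod Y (DiffSp.prod X E)) Y}
    {step' : Hom (DiffSp.prod Y (DiffSp.prod X E')) Y} {init : Hom E Y} {init' : Hom E' Y}
    {e : E} {e' : E'} (hstep : ∀ y x, step (y, (x, e)) = step' (y, (x, e')))
    (hinit : init e = init' e') (m : ℕ) (v : Fin m → X) :
    Hom.foldAux step init e m v = Hom.foldAux step' init' e' m v := by
  induction m with
  | zero => exact hinit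
  | succ m ih =>
    simp only [Hom.foldAux]
    rw [ih, hstep]

theorem Hom.exp_ext {X Y : DiffSp} {f g : DiffSp.exp X Y} (h : ∀ x, Hom.toFun f x = Hom.toFun g x) :
    f = g :=
  Hom.ext (funext h)

theorem Tm.sem_letTuple {Γ : Ctx} {n : ℕ} {σ : Fin n → Ty} {τ : Ty} (t : Tm Γ (Ty.prod n σ))
    (u : Tm (Γ.ext n σ) τ) (d : Γ.sem) :
    (Tm.letTuple t u).sem d = u.sem (Ctx.extend d n σ (t.sem d)) :=
  congrArg u.sem.toFun (Ctx.semExt_apply _ n σ _ d)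

/-- The constructor enters through an equation because the type of the payload and the chosen branch
both depend on it; rewriting inside the unfolded semantics would not be type correct. -/
theorem Tm.sem_case {Γ : Ctx} {n : ℕ} {σ : Fin n → Ty} {τ : Ty} {t : Tm Γ (Ty.variant n σ)}
    {d : Γ.sem} {i : Fin n} {a : (σ i).sem} (h : t.sem d = ⟨i, a⟩) (u : ∀ i, Tm (σ i :: Γ) τ) :
    (Tm.case t u).sem d = (u i).sem ((a, d) : Ctx.sem (σ i :: Γ)) := by
  have key : ∀ s : (Ty.variant n σ).sem, s = ⟨i, a⟩ →
      (u s.1).sem ((s.2, d) : Ctx.sem (σ s.1 :: Γ)) = (u i).sem ((a, d) : Ctx.sem (σ i :: Γ)) := by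
    rintro _ rfl
    rfl
  exact key _ h

theorem Tm.sem_fold {Γ : Ctx} {σ τ : Ty} {u : Tm Γ (Ty.list σ)} {d : Γ.sem} {m : ℕ}
    {l : Fin m → σ.sem} (h : u.sem d = ⟨m, l⟩) (t : Tm (τ :: σ :: Γ) τ) (v : Tm Γ τ) :
    (Tm.fold t u v).sem d = Hom.foldAux t.sem v.sem d m l := by
  change Hom.foldAux _ _ _ (u.sem d).1 (u.sem d).2 = _
  rw [h]

theorem Tm.sem_cons {Γ : Ctx} {σ : Ty} {t : Tm Γ σ} {u : Tm Γ (Ty.list σ)} {d : Γ.sem} {m : ℕ}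
    {l : Fin m → σ.sem} (h : u.sem d = ⟨m, l⟩) :
    (Tm.cons t u).sem d = ⟨m + 1, Fin.cons (t.sem d) l⟩ := by
  change (⟨(u.sem d).1 + 1, Fin.cons (t.sem d) (u.sem d).2⟩ : DiffSp.list _) = _
  rw [h]

theorem Ren.sem_lift {Γ Δ : Ctx} {r : Ren Γ Δ} {d : Δ.sem} {d' : Γ.sem}
    (h : ∀ ⦃τ⦄ (x : Var Γ τ), (r x).sem d = x.sem d') (σ : Ty) (a : σ.sem) :
    ∀ ⦃τ⦄ (x : Var (σ :: Γ) τ), (r.lift σ x).sem ((a, d) : Ctx.sem (σ :: Δ)) =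
      x.sem ((a, d') : Ctx.sem (σ :: Γ))
  | _, .z => rfl
  | _, .s x => h x

theorem Ren.sem_liftN {Γ Δ : Ctx} {r : Ren Γ Δ} {d : Δ.sem} {d' : Γ.sem}
    (h : ∀ ⦃τ⦄ (x : Var Γ τ), (r x).sem d = x.sem d') (n : ℕ) (σ : Fin n → Ty)
    (a : ∀ i, (σ i).sem) :
    ∀ ⦃τ⦄ (x : Var (Γ.ext n σ) τ), (r.liftN n σ x).sem (Ctx.extend d n σ a) =
      x.sem (Ctx.extend d' n σ a) := by
  induction n with
  | zero => exact h
  | succ n ih => exact Ren.sem_lift (ih _ _) (σ 0) (a 0)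

/-- Comparing the semantics at a pair of valuations `d`, `d'` makes the induction pass under
binders: both valuations are extended by the same value. -/
theorem Tm.sem_rename {Γ : Ctx} {τ : Ty} (t : Tm Γ τ) : ∀ {Δ : Ctx} (r : Ren Γ Δ) (d : Δ.sem)
    (d' : Γ.sem), (∀ ⦃τ⦄ (x : Var Γ τ), (r x).sem d = x.sem d') →
      (t.rename r).sem d = t.sem d' := by
  induction t with
  | var x => exact fun r d d' h ↦ h x
  | cst c => exact fun _ _ _ _ ↦ rfl
  | add t u iht ihu =>
    exact fun r d d' h ↦ congrArg₂ (fun a b : ℝ ↦ a + b) (iht r d d' h) (ihu r d d' h)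
  | mul t u iht ihu =>
    exact fun r d d' h ↦ congrArg₂ (fun a b : ℝ ↦ a * b) (iht r d d' h) (ihu r d d' h)
  | sigmoid t ih => exact fun r d d' h ↦ congrArg Hom.sigmoid.toFun (ih r d d' h)
  | tuple t ih => exact fun r d d' h ↦ funext fun i ↦ ih i r d d' h
  | letTuple t u iht ihu =>
    intro Δ r d d' h
    rw [Tm.rename, Tm.sem_letTuple, Tm.sem_letTuple, iht r d d' h]
    exact ihu _ _ _ (Ren.sem_liftN h _ _ _)
  | lam t ih =>
    exact fun r d d' h ↦ Hom.exp_ext fun a ↦ ih _ _ _ (Ren.sem_lift h _ a)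
  | app t u iht ihu =>
    intro Δ r d d' h
    change Hom.toFun ((t.rename r).sem d) ((u.rename r).sem d) = Hom.toFun (t.sem d') (u.sem d')
    rw [iht r d d' h, ihu r d d' h]
  | inj i t ih => exact fun r d d' h ↦ congrArg (Sigma.mk i) (ih r d d' h)
  | case t u iht ihu =>
    intro Δ r d d' h
    obtain ⟨i, a, hi⟩ : ∃ i a, t.sem d' = ⟨i, a⟩ := ⟨_, _, rfl⟩
    rw [Tm.rename, Tm.sem_case hi, Tm.sem_case ((iht r d d' h).trans hi)]
    exact ihu _ _ _ _ (Ren.sem_lift h _ _)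
  | nil => exact fun _ _ _ _ ↦ rfl
  | cons t u iht ihu =>
    intro Δ r d d' h
    obtain ⟨m, l, hl⟩ : ∃ m l, u.sem d' = ⟨m, l⟩ := ⟨_, _, rfl⟩
    rw [Tm.rename, Tm.sem_cons hl, Tm.sem_cons ((ihu r d d' h).trans hl), iht r d d' h]
  | fold t u v iht ihu ihv =>
    intro Δ r d d' h
    obtain ⟨m, l, hl⟩ : ∃ m l, u.sem d' = ⟨m, l⟩ := ⟨_, _, rfl⟩
    rw [Tm.rename, Tm.sem_fold hl, Tm.sem_fold ((ihu r d d' h).trans hl)]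
    exact Hom.foldAux_congr (fun y x ↦ iht _ _ _ (Ren.sem_lift (Ren.sem_lift h _ x) _ y))
      (ihv r d d' h) _ _

theorem Tm.sem_wk {Γ : Ctx} {σ τ : Ty} (t : Tm Γ τ) (a : σ.sem) (d : Γ.sem) :
    (t.wk (σ := σ)).sem ((a, d) : Ctx.sem (σ :: Γ)) = t.sem d :=
  t.sem_rename _ _ _ fun _ _ ↦ rfl

theorem Tm.sem_wkN {Γ : Ctx} {τ : Ty} (t : Tm Γ τ) (n : ℕ) (σ : Fin n → Ty)
    (a : ∀ i, (σ i).sem) (d : Γ.sem) : (t.wkN n σ).sem (Ctx.extend d n σ a) = t.sem d :=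
  t.sem_rename _ _ _ fun _ x ↦ Var.sem_weaken_extend d n σ a x

theorem Sub.sem_lift {Γ Δ : Ctx} {θ : Sub Γ Δ} {d : Δ.sem} {d' : Γ.sem}
    (h : ∀ ⦃τ⦄ (x : Var Γ τ), (θ x).sem d = x.sem d') (σ : Ty) (a : σ.sem) :
    ∀ ⦃τ⦄ (x : Var (σ :: Γ) τ), (θ.lift σ x).sem ((a, d) : Ctx.sem (σ :: Δ)) =
      x.sem ((a, d') : Ctx.sem (σ :: Γ))
  | _, .z => rfl
  | _, .s x => (Tm.sem_wk _ a d).trans (h x)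

theorem Sub.sem_liftN {Γ Δ : Ctx} {θ : Sub Γ Δ} {d : Δ.sem} {d' : Γ.sem}
    (h : ∀ ⦃τ⦄ (x : Var Γ τ), (θ x).sem d = x.sem d') (n : ℕ) (σ : Fin n → Ty)
    (a : ∀ i, (σ i).sem) :
    ∀ ⦃τ⦄ (x : Var (Γ.ext n σ) τ), (θ.liftN n σ x).sem (Ctx.extend d n σ a) =
      x.sem (Ctx.extend d' n σ a) := by
  induction n with
  | zero => exact h
  | succ n ih => exact Sub.sem_lift (ih _ _) (σ 0) (a 0)

/-- Same induction as for renaming. Lifting a substitution under a binder weakens its terms, which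
is why the renaming lemma comes first. -/
theorem Tm.sem_subst {Γ : Ctx} {τ : Ty} (t : Tm Γ τ) : ∀ {Δ : Ctx} (θ : Sub Γ Δ) (d : Δ.sem)
    (d' : Γ.sem), (∀ ⦃τ⦄ (x : Var Γ τ), (θ x).sem d = x.sem d') →
      (t.subst θ).sem d = t.sem d' := by
  induction t with
  | var x => exact fun θ d d' h ↦ h x
  | cst c => exact fun _ _ _ _ ↦ rfl
  | add t u iht ihu =>
    exact fun r d d' h ↦ congrArg₂ (fun a b : ℝ ↦ a + b) (iht r d d' h) (ihu r d d' h)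
  | mul t u iht ihu =>
    exact fun r d d' h ↦ congrArg₂ (fun a b : ℝ ↦ a * b) (iht r d d' h) (ihu r d d' h)
  | sigmoid t ih => exact fun r d d' h ↦ congrArg Hom.sigmoid.toFun (ih r d d' h)
  | tuple t ih => exact fun r d d' h ↦ funext fun i ↦ ih i r d d' h
  | letTuple t u iht ihu =>
    intro Δ r d d' h
    rw [Tm.subst, Tm.sem_letTuple, Tm.sem_letTuple, iht r d d' h]
    exact ihu _ _ _ (Sub.sem_liftN h _ _ _)
  | lam t ih =>
    exact fun r d d' h ↦ Hom.exp_ext fun a ↦ ih _ _ _ (Sub.sem_lift h _ a)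
  | app t u iht ihu =>
    intro Δ r d d' h
    change Hom.toFun ((t.subst r).sem d) ((u.subst r).sem d) = Hom.toFun (t.sem d') (u.sem d')
    rw [iht r d d' h, ihu r d d' h]
  | inj i t ih => exact fun r d d' h ↦ congrArg (Sigma.mk i) (ih r d d' h)
  | case t u iht ihu =>
    intro Δ r d d' h
    obtain ⟨i, a, hi⟩ : ∃ i a, t.sem d' = ⟨i, a⟩ := ⟨_, _, rfl⟩
    rw [Tm.subst, Tm.sem_case hi, Tm.sem_case ((iht r d d' h).trans hi)]
    exact ihu _ _ _ _ (Sub.sem_lift h _ _)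
  | nil => exact fun _ _ _ _ ↦ rfl
  | cons t u iht ihu =>
    intro Δ r d d' h
    obtain ⟨m, l, hl⟩ : ∃ m l, u.sem d' = ⟨m, l⟩ := ⟨_, _, rfl⟩
    rw [Tm.subst, Tm.sem_cons hl, Tm.sem_cons ((ihu r d d' h).trans hl), iht r d d' h]
  | fold t u v iht ihu ihv =>
    intro Δ r d d' h
    obtain ⟨m, l, hl⟩ : ∃ m l, u.sem d' = ⟨m, l⟩ := ⟨_, _, rfl⟩
    rw [Tm.subst, Tm.sem_fold hl, Tm.sem_fold ((ihu r d d' h).trans hl)]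
    exact Hom.foldAux_congr (fun y x ↦ iht _ _ _ (Sub.sem_lift (Sub.sem_lift h _ x) _ y))
      (ihv r d d' h) _ _

/-! ## The logical relation -/

namespace Ty

variable {k : ℕ}

/-- The primal part of a point of `⟦Drev real⟧`. -/
def primal (d : (Ty.real.Drev k).sem) : ℝ := d (0 : Fin 2)

/-- The backpropagator of a point of `⟦Drev real⟧`. -/
def backprop (d : (Ty.real.Drev k).sem) (z : ℝ) : Fin k → ℝ :=
  Hom.toFun (X := DiffSp.real) (Y := (Ty.vec k).sem) (d (1 : Fin 2)) z

/-- The derivative at time zero of a smooth curve in the reals. -/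
def _root_.RevAD.deriv₀ (γ : Hom DiffSp.real DiffSp.real) : ℝ := deriv (F := ℝ) (fun t : ℝ ↦ γ t) 0

/-- The logical relation between smooth curves in `⟦τ⟧` and points of `⟦Drev τ⟧`. At the reals, the
primal part is the value of the curve at time zero, and for `j ∈ o` the backpropagator has the
derivative of the curve as its `j`-th coefficient. -/
def Rel (o : Option (Fin k)) : (τ : Ty) → Hom DiffSp.real τ.sem → (τ.Drev k).sem → Prop
  | .real, γ, d => primal d = γ (0 : ℝ) ∧ ∀ j ∈ o, ∀ z, backprop d z j = z * deriv₀ γ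
  | .prod _ σ, γ, d => ∀ i, (σ i).Rel o
      (Hom.comp (Hom.piProj (X := fun i ↦ (σ i).sem) i) γ) (d i)
  | .fn σ τ, γ, d => ∀ a a', σ.Rel o a a' → τ.Rel o (Hom.app γ a) (Hom.toFun d a')
  | .variant _ σ, γ, d => ∃ γ' : Hom DiffSp.real (σ d.1).sem,
      γ = Hom.comp (Hom.inj (X := fun i ↦ (σ i).sem) d.1) γ' ∧ (σ d.1).Rel o γ' d.2
  | .list σ, γ, d => ∃ γ' : Fin d.1 → Hom DiffSp.real σ.sem,
      γ = Hom.comp (Hom.inj (X := fun m : ℕ ↦ DiffSp.pi fun _ : Fin m ↦ σ.sem) d.1)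
        (Hom.piLift γ') ∧ ∀ i, σ.Rel o (γ' i) (d.2 i)

end Ty

theorem Ty.Rel.congr {k : ℕ} {o : Option (Fin k)} {τ : Ty} {γ γ' : Hom DiffSp.real τ.sem}
    {d d' : (τ.Drev k).sem} (h : τ.Rel o γ' d') (hγ : γ = γ') (hd : d = d') : τ.Rel o γ d := by
  subst hγ hd
  exact h

/-- The logical relation at contexts. -/
def Ctx.Rel {k : ℕ} (o : Option (Fin k)) :
    (Γ : Ctx) → Hom DiffSp.real Γ.sem → Ctx.sem (List.map (Ty.Drev k) Γ) → Prop
  | [], _, _ => True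
  | σ :: Γ, γ, d => σ.Rel o (Hom.comp Hom.fst γ) d.1 ∧ Ctx.Rel o Γ (Hom.comp Hom.snd γ) d.2

theorem Var.rel {k : ℕ} {o : Option (Fin k)} : ∀ {Γ : Ctx} {τ : Ty} (x : Var Γ τ)
    {γ : Hom DiffSp.real Γ.sem} {d : Ctx.sem (List.map (Ty.Drev k) Γ)}, Ctx.Rel o Γ γ d →
      τ.Rel o (Hom.comp x.sem γ) ((x.map (Ty.Drev k)).sem d)
  | _, _, .z, _, _, h => h.1
  | _, _, .s x, _, _, h => x.rel h.2

/-- Transport of points along an equality of contexts. -/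
def Ctx.castSem {Γ Δ : Ctx} (h : Γ = Δ) (d : Γ.sem) : Δ.sem := h ▸ d

theorem Tm.sem_castCtx {Γ Δ : Ctx} {τ : Ty} (h : Γ = Δ) (t : Tm Γ τ) (d : Δ.sem) :
    (Tm.castCtx h t).sem d = t.sem (Ctx.castSem h.symm d) := by
  subst h
  rfl

theorem Ctx.castSem_cons {Γ Δ : Ctx} {σ : Ty} (h : Γ = Δ) (h' : σ :: Γ = σ :: Δ) (a : σ.sem)
    (d : Γ.sem) : Ctx.castSem h' ((a, d) : Ctx.sem (σ :: Γ)) = (a, Ctx.castSem h d) := by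
  subst h
  rfl

theorem Ctx.Rel.congr {k : ℕ} {o : Option (Fin k)} {Γ : Ctx} {γ : Hom DiffSp.real Γ.sem}
    {d d' : Ctx.sem (List.map (Ty.Drev k) Γ)} (h : Ctx.Rel o Γ γ d') (hd : d = d') :
    Ctx.Rel o Γ γ d := by
  subst hd
  exact h

/-- Serves tuple matching. Translating an extended context and extending the translated context give
contexts that are only propositionally equal, so the point has to be transported; `Ctx.castSem_cons`
moves the transport past one variable at a time. -/
theorem Ctx.Rel.extend {k : ℕ} {o : Option (Fin k)} {Γ : Ctx} {γ : Hom DiffSp.real Γ.sem}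
    {d : Ctx.sem (List.map (Ty.Drev k) Γ)} (h : Ctx.Rel o Γ γ d) (n : ℕ) (σ : Fin n → Ty)
    (a : ∀ i, Hom DiffSp.real (σ i).sem) (a' : ∀ i, ((σ i).Drev k).sem)
    (ha : ∀ i, (σ i).Rel o (a i) (a' i)) :
    Ctx.Rel o (Γ.ext n σ) (Ctx.semExt γ n σ a)
      (Ctx.castSem (Ctx.map_ext (Ty.Drev k) Γ n σ).symm
        (Ctx.extend d n (fun i ↦ (σ i).Drev k) a')) := by
  induction n with
  | zero => exact h
  | succ n ih =>
    have e := Ctx.castSem_cons (σ := (σ 0).Drev k)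
      (Ctx.map_ext (Ty.Drev k) Γ n (fun i ↦ σ i.succ)).symm
      (Ctx.map_ext (Ty.Drev k) Γ (n + 1) σ).symm (a' 0)
      (Ctx.extend d n (fun i ↦ (σ i.succ).Drev k) fun i ↦ a' i.succ)
    have h' := ih (fun i ↦ σ i.succ) (fun i ↦ a i.succ) (fun i ↦ a' i.succ) fun i ↦ ha i.succ
    have hr : Ctx.Rel o (Γ.ext (n + 1) σ) (Ctx.semExt γ (n + 1) σ a)
      (a' 0, Ctx.castSem (Ctx.map_ext (Ty.Drev k) Γ n (fun i ↦ σ i.succ)).symm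
        (Ctx.extend d n (fun i ↦ (σ i.succ).Drev k) fun i ↦ a' i.succ)) := ⟨ha 0, h'⟩
    exact hr.congr e

/-! ### The derived operations on the reals -/

namespace Tm

variable {k : ℕ} {Γ : Ctx}

theorem sem_addVec (t u : Tm Γ (Ty.vec k)) (d : Γ.sem) (i : Fin k) :
    ((addVec t u).sem d i : ℝ) = HAdd.hAdd (α := ℝ) (β := ℝ) (t.sem d i) (u.sem d i) := by
  refine congrFun ((sem_letTuple t _ d).trans (sem_letTuple _ _ _)) i |>.trans ?_
  refine congrArg₂ (fun a b : ℝ ↦ a + b) ?_ ?_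
  · exact (Var.sem_weaken_extend _ k _ _ _).trans (Var.sem_bound_extend d k _ _ i)
  · refine (Var.sem_bound_extend _ k _ _ i).trans ?_
    exact congrFun (sem_wkN u k _ _ d) i

/-- The valuation of the four variables of two matched pairs and one bound real. -/
def pairsEnv (p q : (Ty.real.Drev k).sem) (z : ℝ) (d : Γ.sem) :
    Ctx.sem (Ty.real :: Ty.real :: Ty.fn Ty.real (Ty.vec k) :: Ty.real ::
      Ty.fn Ty.real (Ty.vec k) :: Γ) :=
  (z, (q (0 : Fin 2), (q (1 : Fin 2), (p (0 : Fin 2), (p (1 : Fin 2), d)))))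

/-- Everything unfolds by computation except that `u` has been weakened past the two variables
matched from `t`; two uses of `sem_wk` undo this. The same holds for the next three lemmas. -/
theorem primal_addRev (t u : Tm Γ (Ty.real.Drev k)) (d : Γ.sem) :
    Ty.primal ((addRev k t u).sem d) = Ty.primal (t.sem d) + Ty.primal (u.sem d) := by
  refine congrArg (fun s ↦ Ty.primal (t.sem d) + Ty.primal s)
    (a₂ := u.sem d) (?_ : u.wk.wk.sem _ = _)
  exact (sem_wk _ _ _).trans (sem_wk _ _ _)

theorem backprop_addRev (t u : Tm Γ (Ty.real.Drev k)) (d : Γ.sem) (z : ℝ) (j : Fin k) :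
    Ty.backprop ((addRev k t u).sem d) z j =
      Ty.backprop (t.sem d) z j + Ty.backprop (u.sem d) z j := by
  refine (sem_addVec (.app v4 v0) (.app v2 v0) (pairsEnv (t.sem d) (u.wk.wk.sem
    ((t.sem d (0 : Fin 2), (t.sem d (1 : Fin 2), d)) :
      Ctx.sem (Ty.real :: Ty.fn Ty.real (Ty.vec k) :: Γ))) z d) j).trans ?_
  refine congrArg (fun s ↦ Ty.backprop (t.sem d) z j + Ty.backprop s z j)
    (a₂ := u.sem d) (?_ : u.wk.wk.sem _ = _)
  exact (sem_wk _ _ _).trans (sem_wk _ _ _)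

theorem primal_mulRev (t u : Tm Γ (Ty.real.Drev k)) (d : Γ.sem) :
    Ty.primal ((mulRev k t u).sem d) = Ty.primal (t.sem d) * Ty.primal (u.sem d) := by
  refine congrArg (fun s ↦ Ty.primal (t.sem d) * Ty.primal s)
    (a₂ := u.sem d) (?_ : u.wk.wk.sem _ = _)
  exact (sem_wk _ _ _).trans (sem_wk _ _ _)

theorem backprop_mulRev (t u : Tm Γ (Ty.real.Drev k)) (d : Γ.sem) (z : ℝ) (j : Fin k) :
    Ty.backprop ((mulRev k t u).sem d) z j =
      Ty.backprop (t.sem d) (Ty.primal (u.sem d) * z) j +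
        Ty.backprop (u.sem d) (Ty.primal (t.sem d) * z) j := by
  refine (sem_addVec (.app v4 (.mul v1 v0)) (.app v2 (.mul v3 v0)) (pairsEnv (t.sem d)
    (u.wk.wk.sem ((t.sem d (0 : Fin 2), (t.sem d (1 : Fin 2), d)) :
      Ctx.sem (Ty.real :: Ty.fn Ty.real (Ty.vec k) :: Γ))) z d) j).trans ?_
  refine congrArg (fun s ↦ Ty.backprop (t.sem d) (Ty.primal s * z) j +
    Ty.backprop s (Ty.primal (t.sem d) * z) j) (a₂ := u.sem d) (?_ : u.wk.wk.sem _ = _)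
  exact (sem_wk _ _ _).trans (sem_wk _ _ _)

/-- The sigmoid function on the reals. -/
def sigmoidFun (x : ℝ) : ℝ := 1 / (1 + Real.exp (-x))

theorem primal_sigmoidRev (t : Tm Γ (Ty.real.Drev k)) (d : Γ.sem) :
    Ty.primal ((sigmoidRev k t).sem d) = sigmoidFun (Ty.primal (t.sem d)) := rfl

theorem backprop_sigmoidRev (t : Tm Γ (Ty.real.Drev k)) (d : Γ.sem) (z : ℝ) (j : Fin k) :
    Ty.backprop ((sigmoidRev k t).sem d) z j = Ty.backprop (t.sem d)
      (sigmoidFun (Ty.primal (t.sem d)) * (1 + -1 * sigmoidFun (Ty.primal (t.sem d))) * z) j := rfl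

end Tm

/-- The derivative is written exactly as the translated term evaluates, with the subtraction `1 - y`
encoded as `1 + -1 * y`. -/
theorem hasDerivAt_sigmoid (x : ℝ) :
    HasDerivAt Tm.sigmoidFun (Tm.sigmoidFun x * (1 + -1 * Tm.sigmoidFun x)) x := by
  have h : (1 + Real.exp (-x)) ≠ 0 := by positivity
  have h1 : HasDerivAt (fun x ↦ 1 + Real.exp (-x)) (Real.exp (-x) * -1) x :=
    ((hasDerivAt_neg x).exp).const_add 1
  convert! (hasDerivAt_const x (1 : ℝ)).div h1 h using 1
  simp only [Tm.sigmoidFun]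
  field_simp
  ring

theorem Hom.contDiff_real (γ : Hom DiffSp.real DiffSp.real) :
    ContDiff (F := ℝ) ℝ ∞ (fun t : ℝ ↦ γ t) :=
  DSmooth.contDiff (X := ℝ) (Y := ℝ) γ.smooth

theorem Hom.hasDerivAt_real (γ : Hom DiffSp.real DiffSp.real) :
    HasDerivAt (F := ℝ) (fun t : ℝ ↦ γ t) (deriv₀ γ) 0 :=
  (γ.contDiff_real.differentiable (by simp) _).hasDerivAt

/-! ### The fundamental lemma -/

/-- The length of the list is constant along the curve, so the folded curve `c` is obtained by
applying the step map to curves `m` times. Building it in this way gives its smoothness and the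
relation together. -/
theorem Ty.Rel.foldAux {k : ℕ} {o : Option (Fin k)} {E E' : DiffSp} {σ τ : Ty}
    {step : Hom (DiffSp.prod τ.sem (DiffSp.prod σ.sem E)) τ.sem} {init : Hom E τ.sem}
    {step' : Hom (DiffSp.prod (τ.Drev k).sem (DiffSp.prod (σ.Drev k).sem E')) (τ.Drev k).sem}
    {init' : Hom E' (τ.Drev k).sem} {γ : Hom DiffSp.real E} {d : E'}
    (hstep : ∀ (y : Hom DiffSp.real τ.sem) y' (x : Hom DiffSp.real σ.sem) x',
      τ.Rel o y y' → σ.Rel o x x' →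
        τ.Rel o (Hom.comp step (Hom.pair y (Hom.pair x γ))) (step' (y', (x', d))))
    (hinit : τ.Rel o (Hom.comp init γ) (init' d)) (m : ℕ) (l : Fin m → Hom DiffSp.real σ.sem)
    (l' : Fin m → (σ.Drev k).sem) (hl : ∀ i, σ.Rel o (l i) (l' i)) :
    ∃ c : Hom DiffSp.real τ.sem,
      (∀ s, c s = Hom.foldAux step init (γ s) m fun i ↦ l i s) ∧
        τ.Rel o c (Hom.foldAux step' init' d m l') := by
  induction m with
  | zero => exact ⟨_, fun _ ↦ rfl, hinit⟩
  | succ m ih =>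
    obtain ⟨c, hc, hcr⟩ := ih (fun i ↦ l i.succ) (fun i ↦ l' i.succ) fun i ↦ hl i.succ
    refine ⟨_, fun s ↦ ?_, hstep c _ (l 0) _ hcr (hl 0)⟩
    exact congrArg (fun y ↦ step (y, (l 0 s, γ s))) (hc s)

/-- Backpropagators of related points are linear in `z`, so the sum, product and sigmoid cases
reduce to the differentiation rules. Abstraction and application are immediate from the clause for
function types. For variants and lists the relation itself keeps the whole curve in one summand. -/
theorem Tm.rel {k : ℕ} {o : Option (Fin k)} {Γ : Ctx} {τ : Ty} (t : Tm Γ τ) :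
    ∀ {γ : Hom DiffSp.real Γ.sem} {d : Ctx.sem (List.map (Ty.Drev k) Γ)}, Ctx.Rel o Γ γ d →
      τ.Rel o (Hom.comp t.sem γ) ((t.Drev k).sem d) := by
  induction t with
  | var x => exact fun h ↦ x.rel h
  | cst c =>
    intro γ d _
    refine ⟨rfl, fun j _ z ↦ ?_⟩
    have : deriv₀ (Hom.comp (Hom.const (Y := DiffSp.real) c) γ) = 0 := deriv_const (0 : ℝ) c
    exact (mul_eq_zero_of_right z this).symm
  | add t u iht ihu =>
    intro γ d h
    obtain ⟨ht, ht'⟩ := iht h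
    obtain ⟨hu, hu'⟩ := ihu h
    have hd : deriv₀ (Hom.comp (Tm.add t u).sem γ) =
        deriv₀ (Hom.comp t.sem γ) + deriv₀ (Hom.comp u.sem γ) :=
      ((Hom.hasDerivAt_real (Hom.comp t.sem γ)).add
        (Hom.hasDerivAt_real (Hom.comp u.sem γ))).deriv
    refine ⟨(primal_addRev _ _ d).trans (congrArg₂ (fun a b : ℝ ↦ a + b) ht hu), fun j hj z ↦ ?_⟩
    refine (backprop_addRev _ _ d z j).trans (Eq.trans ?_ (congrArg (z * ·) hd.symm))
    rw [ht' j hj, hu' j hj]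
    exact (mul_add z _ _).symm
  | mul t u iht ihu =>
    intro γ d h
    obtain ⟨ht, ht'⟩ := iht h
    obtain ⟨hu, hu'⟩ := ihu h
    have hd : deriv₀ (Hom.comp (Tm.mul t u).sem γ) =
        deriv₀ (Hom.comp t.sem γ) * Ty.primal ((u.Drev k).sem d) +
          Ty.primal ((t.Drev k).sem d) * deriv₀ (Hom.comp u.sem γ) := by
      rw [ht, hu]
      exact ((Hom.hasDerivAt_real (Hom.comp t.sem γ)).mul
        (Hom.hasDerivAt_real (Hom.comp u.sem γ))).deriv
    refine ⟨(primal_mulRev _ _ d).trans (congrArg₂ (fun a b : ℝ ↦ a * b) ht hu), fun j hj z ↦ ?_⟩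
    refine (backprop_mulRev _ _ d z j).trans (Eq.trans ?_ (congrArg (z * ·) hd.symm))
    rw [ht' j hj, hu' j hj]
    have key : ∀ p q x y : ℝ, q * z * x + p * z * y = z * (x * q + p * y) := fun _ _ _ _ ↦ by ring
    exact key _ _ _ _
  | sigmoid t ih =>
    intro γ d h
    obtain ⟨ht, ht'⟩ := ih h
    have hd : deriv₀ (Hom.comp (Tm.sigmoid t).sem γ) =
        sigmoidFun (Ty.primal ((t.Drev k).sem d)) *
          (1 + -1 * sigmoidFun (Ty.primal ((t.Drev k).sem d))) *
            deriv₀ (Hom.comp t.sem γ) := by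
      rw [ht]
      exact ((hasDerivAt_sigmoid _).comp (0 : ℝ) (Hom.hasDerivAt_real (Hom.comp t.sem γ))).deriv
    refine ⟨(primal_sigmoidRev _ d).trans (congrArg sigmoidFun ht), fun j hj z ↦ ?_⟩
    refine (backprop_sigmoidRev _ d z j).trans (Eq.trans ?_ (congrArg (z * ·) hd.symm))
    rw [ht' j hj]
    have key : ∀ p x : ℝ, p * z * x = z * (p * x) := fun _ _ ↦ by ring
    exact key _ _
  | tuple t ih => exact fun h i ↦ ih i h
  | @letTuple Γ n σ τ t u iht ihu =>
    intro γ d h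
    refine (ihu (h.extend n σ _ _ (iht h))).congr ?_
      ((sem_letTuple (t.Drev k) _ d).trans (sem_castCtx _ _ _))
    refine Hom.ext (funext fun s ↦ ?_)
    refine (sem_letTuple t u _).trans (congrArg u.sem.toFun ?_)
    exact (Ctx.semExt_apply γ n σ (fun i ↦ Hom.comp (Hom.piProj (X := fun i ↦ (σ i).sem) i)
      (Hom.comp t.sem γ)) s).symm
  | lam t ih => exact fun {γ d} h a a' ha ↦ ih (γ := Hom.pair a γ) (d := (a', d)) ⟨ha, h⟩
  | app t u iht ihu => exact fun h ↦ iht h _ _ (ihu h)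
  | inj i t ih => exact fun h ↦ ⟨_, rfl, ih h⟩
  | @case Γ n σ τ t u iht ihu =>
    intro γ d h
    obtain ⟨i, a, hi⟩ : ∃ i a, (t.Drev k).sem d = ⟨i, a⟩ := ⟨_, _, rfl⟩
    have ht := iht h
    rw [hi] at ht
    -- The curve stays in the summand `i` of the related point, so the same branch is taken at all
    -- times.
    obtain ⟨γ', hγ', hr⟩ := ht
    exact (ihu i (γ := Hom.pair γ' γ) (d := (a, d)) ⟨hr, h⟩).congr
      (Hom.ext (funext fun s ↦ sem_case (congrArg (fun g ↦ Hom.toFun g s) hγ') u))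
      (sem_case (t := t.Drev k) hi _)
  | nil => exact fun h ↦ ⟨fun i ↦ i.elim0,
      Hom.ext (funext fun s ↦ congrArg (Sigma.mk 0) (funext fun i ↦ i.elim0)), fun i ↦ i.elim0⟩
  | @cons Γ σ t u iht ihu =>
    intro γ d h
    obtain ⟨m, l, hl⟩ : ∃ m l, (u.Drev k).sem d = ⟨m, l⟩ := ⟨_, _, rfl⟩
    have hu := ihu h
    rw [hl] at hu
    obtain ⟨γ', hγ', hr⟩ := hu
    refine Ty.Rel.congr (τ := Ty.list σ) (γ := Hom.comp (Tm.cons t u).sem γ) ?_ rfl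
      (sem_cons (t := t.Drev k) (u := u.Drev k) hl)
    refine ⟨Fin.cons (Hom.comp t.sem γ) γ', Hom.ext (funext fun s ↦ ?_), fun i ↦ ?_⟩
    · refine (sem_cons (t := t) (congrArg (fun g ↦ Hom.toFun g s) hγ')).trans ?_
      refine congrArg (Sigma.mk (m + 1)) (funext fun i ↦ ?_)
      refine Fin.cases rfl (fun i ↦ rfl) i
    · refine Fin.cases (iht h) (fun i ↦ hr i) i
  | fold t u v iht ihu ihv =>
    intro γ d h
    obtain ⟨m, l, hl⟩ : ∃ m l, (u.Drev k).sem d = ⟨m, l⟩ := ⟨_, _, rfl⟩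
    have hu := ihu h
    rw [hl] at hu
    obtain ⟨γ', hγ', hr⟩ := hu
    obtain ⟨c, hc, hcr⟩ := Ty.Rel.foldAux (step := t.sem) (init := v.sem) (γ := γ)
      (step' := (t.Drev k).sem) (init' := (v.Drev k).sem) (d := d)
      (fun y y' x x' hy hx ↦ iht (γ := Hom.pair y (Hom.pair x γ)) (d := (y', (x', d)))
        ⟨hy, hx, h⟩) (ihv h) m γ' l hr
    refine hcr.congr (Hom.ext (funext fun s ↦ ?_)) (sem_fold (u := u.Drev k) hl _ _)
    exact (sem_fold (congrArg (fun g ↦ Hom.toFun g s) hγ') t v).trans (hc s).symm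

/-! ## Diffeomorphisms -/

/-- An injective smooth map along which plots lift is a diffeomorphism. -/
theorem IsDiffeo.of_lift {X Y : DiffSp} {f : X → Y} (hf : DSmooth f)
    (hinj : Function.Injective f)
    (hlift : ∀ (n : ℕ) (p : EuclideanSpace ℝ (Fin n) → Y), IsPlot p →
      ∃ q : EuclideanSpace ℝ (Fin n) → X, IsPlot q ∧ ∀ u, f (q u) = p u) : IsDiffeo f := by
  have hsurj : Function.Surjective f := fun y ↦ by
    -- A point is a plot on `ℝ⁰`, so lifting of plots includes surjectivity.
    obtain ⟨q, -, hq⟩ := hlift 0 (fun _ ↦ y) (DiffeologicalSpace.constant_plots y)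
    exact ⟨_, hq 0⟩
  choose g hg using hsurj
  refine ⟨hf, g, fun n p hp ↦ ?_, fun x ↦ hinj (hg _), hg⟩
  obtain ⟨q, hq, hpq⟩ := hlift n p hp
  -- By injectivity the set-theoretic inverse must agree with the given smooth lift.
  have : g ∘ p = q := funext fun u ↦ hinj ((hg _).trans (hpq u).symm)
  rwa [this]

theorem IsDiffeo.injective {X Y : DiffSp} {f : X → Y} (hf : IsDiffeo f) :
    Function.Injective f := by
  obtain ⟨-, g, -, hgf, -⟩ := hf
  exact hgf.injective

theorem IsDiffeo.lift {X Y : DiffSp} {f : X → Y} (hf : IsDiffeo f) {n : ℕ}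
    {p : EuclideanSpace ℝ (Fin n) → Y} (hp : IsPlot p) :
    ∃ q : EuclideanSpace ℝ (Fin n) → X, IsPlot q ∧ ∀ u, f (q u) = p u := by
  obtain ⟨-, g, hg, -, hfg⟩ := hf
  exact ⟨g ∘ p, hg n p hp, fun u ↦ hfg _⟩

theorem IsDiffeo.comp {X Y Z : DiffSp} {g : Y → Z} {f : X → Y} (hg : IsDiffeo g)
    (hf : IsDiffeo f) : IsDiffeo (X := X) (Y := Z) (fun x ↦ g (f x)) := by
  refine IsDiffeo.of_lift (fun n p hp ↦ hg.1 n _ (hf.1 n p hp))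
    (fun x y h ↦ hf.injective (hg.injective h)) fun n p hp ↦ ?_
  obtain ⟨q, hq, hpq⟩ := hg.lift hp
  obtain ⟨r, hr, hqr⟩ := hf.lift hq
  exact ⟨r, hr, fun u ↦ by rw [hqr, hpq]⟩

theorem IsDiffeo.piMap {ι : Type} {X Y : ι → DiffSp} {f : ∀ i, X i → Y i}
    (hf : ∀ i, IsDiffeo (f i)) :
    IsDiffeo (X := DiffSp.pi X) (Y := DiffSp.pi Y) (fun x i ↦ f i (x i)) := by
  refine IsDiffeo.of_lift
    (fun n p hp ↦ DiffSp.isPlot_pi.2 fun i ↦ (hf i).1 n _ (DiffSp.isPlot_pi.1 hp i))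
    (fun x y h ↦ funext fun i ↦ (hf i).injective (congrFun h i)) fun n p hp ↦ ?_
  choose q hq hpq using fun i ↦ (hf i).lift (DiffSp.isPlot_pi.1 hp i)
  exact ⟨fun u i ↦ q i u, DiffSp.isPlot_pi.2 hq, fun u ↦ funext fun i ↦ hpq i u⟩

theorem IsDiffeo.prodMap {X Y X' Y' : DiffSp} {f : X → Y} {f' : X' → Y'} (hf : IsDiffeo f)
    (hf' : IsDiffeo f') :
    IsDiffeo (X := DiffSp.prod X X') (Y := DiffSp.prod Y Y') (fun x ↦ (f x.1, f' x.2)) := by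
  refine IsDiffeo.of_lift (fun n p hp ↦ DiffSp.isPlot_prod.2
      ⟨hf.1 n _ (DiffSp.isPlot_prod.1 hp).1, hf'.1 n _ (DiffSp.isPlot_prod.1 hp).2⟩)
    (fun x y h ↦ Prod.ext (hf.injective (congrArg Prod.fst h))
      (hf'.injective (congrArg Prod.snd h))) fun n p hp ↦ ?_
  obtain ⟨q, hq, hpq⟩ := hf.lift (DiffSp.isPlot_prod.1 hp).1
  obtain ⟨q', hq', hpq'⟩ := hf'.lift (DiffSp.isPlot_prod.1 hp).2
  exact ⟨fun u ↦ (q u, q' u), DiffSp.isPlot_prod.2 ⟨hq, hq'⟩,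
    fun u ↦ Prod.ext (hpq u) (hpq' u)⟩

theorem IsDiffeo.sigmaMap {ι : Type} {X Y : ι → DiffSp} {f : ∀ i, X i → Y i}
    (hf : ∀ i, IsDiffeo (f i)) :
    IsDiffeo (X := DiffSp.sigma X) (Y := DiffSp.sigma Y) (fun x ↦ ⟨x.1, f x.1 x.2⟩) := by
  refine IsDiffeo.of_lift ?_ ?_ ?_
  · rintro n _ ⟨i, q, hq, rfl⟩
    exact ⟨i, _, (hf i).1 n q hq, rfl⟩
  · exact Function.Injective.sigma_map (f₁ := fun i : ι ↦ i) Function.injective_id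
      fun i ↦ (hf i).injective
  · rintro n _ ⟨i, q, hq, rfl⟩
    obtain ⟨r, hr, hqr⟩ := (hf i).lift hq
    exact ⟨fun u ↦ ⟨i, r u⟩, ⟨i, r, hr, rfl⟩, fun u ↦ congrArg (Sigma.mk i) (hqr u)⟩

/-! ## Maps out of Euclidean spaces -/

namespace Hom

theorem isPlot_comp_contDiff {n : ℕ} {Y : DiffSp}
    (F : Hom (DiffSp.prod (DiffSp.euc n) DiffSp.real) Y) {m : ℕ}
    {g : EuclideanSpace ℝ (Fin m) → EuclideanSpace ℝ (Fin n) × ℝ} (hg : ContDiff ℝ ∞ g) :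
    IsPlot (fun u ↦ F (g u)) :=
  F.smooth m g (DiffSp.isPlot_prod.2 ⟨hg.fst, hg.snd⟩)

/-- Plots are parametrised by Euclidean spaces only, so the domain `ℝⁿ × ℝ` is first identified
linearly with one. -/
theorem contDiff_prod {n : ℕ} (F : Hom (DiffSp.prod (DiffSp.euc n) DiffSp.real) DiffSp.real) :
    ContDiff (E := EuclideanSpace ℝ (Fin n) × ℝ) (F := ℝ) ℝ ∞ F.toFun := by
  let g := toEuclidean (E := EuclideanSpace ℝ (Fin n) × ℝ)
  have h : ContDiff (F := ℝ) ℝ ∞ (fun u ↦ F (g.symm u)) := F.isPlot_comp_contDiff g.symm.contDiff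
  have e : F.toFun = (fun u ↦ F (g.symm u)) ∘ g :=
    funext fun z ↦ congrArg F.toFun (g.symm_apply_apply z).symm
  exact e ▸ h.comp g.contDiff

/-- A smooth map from a retract of a Euclidean space to a disjoint union factors through one
summand. -/
theorem exists_eq_inj_comp {ι : Type} {X : ι → DiffSp} {Y : DiffSp} {m : ℕ}
    (e : Hom (DiffSp.euc m) Y) (e' : Hom Y (DiffSp.euc m)) (h : ∀ y, e (e' y) = y)
    (F : Hom Y (DiffSp.sigma X)) : ∃ (i : ι) (F' : Hom Y (X i)), F = comp (inj i) F' := by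
  -- The map `e` is itself a plot, so `F ∘ e` is a plot of the disjoint union and thus has a
  -- constant index.
  obtain ⟨i, q, hq, hF⟩ := F.smooth m e.toFun (e.smooth m _ isPlot_id)
  refine ⟨i, comp ⟨q, hq.dSmooth⟩ e', Hom.ext (funext fun y ↦ ?_)⟩
  have := congrFun hF (e' y)
  exact (congrArg F.toFun (h y)).symm.trans this

theorem exists_eq_inj_comp_real {ι : Type} {X : ι → DiffSp} (F : Hom DiffSp.real (DiffSp.sigma X)) :
    ∃ (i : ι) (F' : Hom DiffSp.real (X i)), F = comp (inj i) F' := by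
  let g := toEuclidean (E := ℝ)
  have h₁ : DSmooth g.symm := g.symm.contDiff.dSmooth
  have h₂ : DSmooth g := g.contDiff.dSmooth
  exact exists_eq_inj_comp (m := Module.finrank ℝ ℝ) ⟨_, h₁⟩ ⟨_, h₂⟩
    g.symm_apply_apply F

theorem exists_eq_inj_comp_prod {ι : Type} {X : ι → DiffSp} {n : ℕ}
    (F : Hom (DiffSp.prod (DiffSp.euc n) DiffSp.real) (DiffSp.sigma X)) :
    ∃ (i : ι) (F' : Hom (DiffSp.prod (DiffSp.euc n) DiffSp.real) (X i)), F = comp (inj i) F' := by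
  let g := toEuclidean (E := EuclideanSpace ℝ (Fin n) × ℝ)
  refine exists_eq_inj_comp (m := Module.finrank ℝ (EuclideanSpace ℝ (Fin n) × ℝ))
    ⟨fun u ↦ g.symm u, fun m p hp ↦ ?_⟩ ⟨fun z ↦ g z, fun m p hp ↦ ?_⟩ g.symm_apply_apply F
  · have : ContDiff ℝ ∞ (fun u ↦ g.symm (p u)) := g.symm.contDiff.comp hp
    exact DiffSp.isPlot_prod.2 ⟨this.fst, this.snd⟩
  · have h₁ : ContDiff (F := EuclideanSpace ℝ (Fin n)) ℝ ∞ (fun u ↦ (p u).1) :=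
      (DiffSp.isPlot_prod.1 hp).1
    have h₂ : ContDiff (F := ℝ) ℝ ∞ (fun u ↦ (p u).2) :=
      (DiffSp.isPlot_prod.1 hp).2
    exact g.contDiff.comp (h₁.prodMk h₂)

end Hom

/-! ## Tangent vectors -/

/-- The point of the tangent bundle given by a smooth curve. -/
def curveTangent {X : DiffSp} (γ : Hom DiffSp.real X) : X.tangent := ⟨γ (0 : ℝ), velocity γ⟩

theorem mk_eq_curveTangent {X : DiffSp} {x : X} (γ : Curve X x) :
    (⟨x, Quotient.mk _ γ⟩ : X.tangent) = curveTangent γ.1 := by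
  obtain ⟨γ, rfl⟩ := γ
  rfl

theorem mk_eq_curveTangent_out {X : DiffSp} {x : X} (v : TangentSp X x) :
    (⟨x, v⟩ : X.tangent) = curveTangent v.out.1 :=
  (congrArg (Sigma.mk x) v.out_eq.symm).trans (mk_eq_curveTangent v.out)

/-- Tangency expressed in the total space, which avoids transporting vectors between fibres over
base points that are only propositionally equal. -/
theorem curveTangent_eq_iff {X : DiffSp} {γ γ' : Hom DiffSp.real X} :
    curveTangent γ = curveTangent γ' ↔ γ (0 : ℝ) = γ' (0 : ℝ) ∧
      ∀ f : Hom X DiffSp.real, deriv₀ (Hom.comp f γ) = deriv₀ (Hom.comp f γ') := by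
  constructor
  · intro h
    have h0 : γ (0 : ℝ) = γ' (0 : ℝ) := congrArg Sigma.fst h
    refine ⟨h0, ?_⟩
    have h1 := (mk_eq_curveTangent ⟨γ, h0⟩).trans h
    exact Quotient.exact (eq_of_heq (Sigma.mk.inj h1).2)
  · rintro ⟨h0, h⟩
    refine (mk_eq_curveTangent ⟨γ, h0⟩).symm.trans ?_
    exact congrArg (Sigma.mk _) (Quotient.sound h)

/-- The action of the tangent functor on smooth maps. -/
def tangentBundleMap {X Y : DiffSp} (f : Hom X Y) (v : X.tangent) : Y.tangent :=
  ⟨f v.1, TangentSp.map f v.1 v.2⟩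

theorem tangentBundleMap_curveTangent {X Y : DiffSp} (f : Hom X Y) (γ : Hom DiffSp.real X) :
    tangentBundleMap f (curveTangent γ) = curveTangent (Hom.comp f γ) := rfl

/-- The `j`-th tangent vector of a point of the fibre product. -/
def DiffSp.tangentPowProj {k : ℕ} {X : DiffSp} (j : Fin k) (v : X.tangentPow k) : X.tangent :=
  ⟨v.1, v.2 j⟩

open DiffSp (tangentPowProj)

/-- Equality of base points is a separate hypothesis because for `k = 0` no projection records it.
-/
theorem tangentPow_ext {k : ℕ} {X : DiffSp} {v w : X.tangentPow k} (h : v.1 = w.1)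
    (hj : ∀ j, tangentPowProj j v = tangentPowProj j w) : v = w := by
  obtain ⟨x, v⟩ := v
  obtain ⟨y, w⟩ := w
  obtain rfl : x = y := h
  exact congrArg (Sigma.mk x) (funext fun j ↦ eq_of_heq (Sigma.mk.inj (hj j)).2)

theorem isPlot_tangentPow {k : ℕ} {X : DiffSp} {n : ℕ}
    {p : EuclideanSpace ℝ (Fin n) → X.tangentPow k} :
    IsPlot p ↔ IsPlot (fun u ↦ (p u).1) ∧ ∀ j, IsPlot (fun u ↦ tangentPowProj j (p u)) :=
  DiffeologicalSpace.isPlot_inf_iff.trans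
    (and_congr Iff.rfl DiffeologicalSpace.isPlot_iInf_iff)

/-! ### Plots of the tangent bundle -/

/-- The maps to the tangent bundle given by smooth families of curves. -/
def IsCurveFamily {X : DiffSp} {n : ℕ} (p : EuclideanSpace ℝ (Fin n) → X.tangent) : Prop :=
  ∃ F : Hom (DiffSp.prod (DiffSp.euc n) DiffSp.real) X, ∀ u : DiffSp.euc n,
    p u = curveTangent (Hom.comp F (Hom.pair (Hom.const u) (Hom.id DiffSp.real)))

theorem IsCurveFamily.isPlot {X : DiffSp} {n : ℕ} {p : EuclideanSpace ℝ (Fin n) → X.tangent}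
    (hp : IsCurveFamily p) : IsPlot p :=
  DiffeologicalSpace.isPlot_generatedFrom_of_mem hp

theorem IsCurveFamily.const {X : DiffSp} {n : ℕ} (v : X.tangent) :
    IsCurveFamily (fun _ : EuclideanSpace ℝ (Fin n) ↦ v) :=
  ⟨Hom.comp v.2.out.1 Hom.snd, fun _ ↦ mk_eq_curveTangent_out v.2⟩

theorem IsCurveFamily.reparam {X : DiffSp} {n m : ℕ} {p : EuclideanSpace ℝ (Fin n) → X.tangent}
    (hp : IsCurveFamily p) {f : EuclideanSpace ℝ (Fin m) → EuclideanSpace ℝ (Fin n)}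
    (hf : ContDiff ℝ ∞ f) : IsCurveFamily (p ∘ f) := by
  obtain ⟨F, hF⟩ := hp
  have hf' : DSmooth f := hf.dSmooth
  exact ⟨Hom.comp F (Hom.pair (Hom.comp (X := DiffSp.prod (DiffSp.euc m) DiffSp.real)
    (Y := DiffSp.euc m) (Z := DiffSp.euc n) ⟨f, hf'⟩ Hom.fst) Hom.snd), fun u ↦ hF (f u)⟩

/-- The maps to the tangent bundle that locally are smooth families of curves. -/
def IsLocalCurveFamily {X : DiffSp} {n : ℕ} (p : EuclideanSpace ℝ (Fin n) → X.tangent) : Prop :=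
  ∀ x, ∃ U : Set (EuclideanSpace ℝ (Fin n)), IsOpen U ∧ x ∈ U ∧
    ∀ {m : ℕ} {f : EuclideanSpace ℝ (Fin m) → EuclideanSpace ℝ (Fin n)}, (∀ y, f y ∈ U) →
      ContDiff ℝ ∞ f → IsCurveFamily (p ∘ f)

/-- A ball around `x` inside `U` is the image of the whole `ℝⁿ` under a smooth chart `b`, so the
hypothesis applies to `p ∘ b` and yields an open `V` around `b⁻¹ x`. The image of `V` under `b` is
the neighbourhood sought: a map `f` into it factors smoothly as `b ∘ (b⁻¹ ∘ f)`. -/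
theorem isLocalCurveFamily_of_local {X : DiffSp} {n : ℕ}
    {p : EuclideanSpace ℝ (Fin n) → X.tangent}
    (hp : ∀ x, ∃ U : Set (EuclideanSpace ℝ (Fin n)), IsOpen U ∧ x ∈ U ∧
      ∀ {m : ℕ} {f : EuclideanSpace ℝ (Fin m) → EuclideanSpace ℝ (Fin n)}, (∀ y, f y ∈ U) →
        ContDiff ℝ ∞ f → IsLocalCurveFamily (p ∘ f)) : IsLocalCurveFamily p := by
  intro x
  obtain ⟨U, hU, hxU, h⟩ := hp x
  obtain ⟨ε, hε, hεU⟩ := Metric.isOpen_iff.mp hU x hxU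
  set b := OpenPartialHomeomorph.univBall x ε with hb
  have htarget : b.target = Metric.ball x ε := OpenPartialHomeomorph.univBall_target x hε
  have hsource : b.source = Set.univ := OpenPartialHomeomorph.univBall_source x ε
  have himg : ∀ y, b y ∈ U := fun y ↦ hεU (htarget ▸ b.map_source (hsource ▸ Set.mem_univ y))
  have hx : x ∈ b.target := htarget ▸ Metric.mem_ball_self hε
  obtain ⟨V, hV, hxV, hVp⟩ := h himg OpenPartialHomeomorph.contDiff_univBall (b.symm x)
  refine ⟨b.target ∩ b.symm ⁻¹' V, b.isOpen_inter_preimage_symm hV, ⟨hx, hxV⟩, ?_⟩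
  intro m f hf hfs
  have hg : ContDiff ℝ ∞ (b.symm ∘ f) := by
    rw [← contDiffOn_univ]
    refine (OpenPartialHomeomorph.contDiffOn_univBall_symm (c := x) (r := ε)).comp
      hfs.contDiffOn fun y _ ↦ ?_
    exact htarget ▸ (hf y).1
  have := hVp (f := b.symm ∘ f) (fun y ↦ (hf y).2) hg
  convert! this using 1
  funext y
  exact congrArg p (b.right_inv (hf y).1).symm

/-- Plots of the tangent bundle locally are smooth families of curves. -/
theorem isLocalCurveFamily_of_isPlot {X : DiffSp} {n : ℕ}
    {p : EuclideanSpace ℝ (Fin n) → X.tangent} (hp : IsPlot p) : IsLocalCurveFamily p := by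
  -- The local curve families form a diffeology containing the generators, hence contain every plot
  -- of the generated diffeology.
  let d : DiffeologicalSpace X.tangent :=
    { plots _ := {p | IsLocalCurveFamily p}
      constant_plots v x := ⟨Set.univ, isOpen_univ, Set.mem_univ x, fun _ _ ↦ IsCurveFamily.const v⟩
      plot_reparam := by
        intro n m p f hp hf x
        obtain ⟨U, hU, hxU, h⟩ := hp (f x)
        exact ⟨f ⁻¹' U, hU.preimage hf.continuous, hxU,
          fun {l g} hg hgs ↦ h (f := f ∘ g) hg (hf.comp hgs)⟩
      locality := isLocalCurveFamily_of_local }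
  refine hp d ?_
  rintro ⟨m, q⟩ hq x
  exact ⟨Set.univ, isOpen_univ, Set.mem_univ x, fun _ hf ↦ IsCurveFamily.reparam hq hf⟩

theorem dSmooth_tangentBundleMap {X Y : DiffSp} (f : Hom X Y) : DSmooth (tangentBundleMap f) := by
  intro n p hp
  refine DiffeologicalSpace.locality fun x ↦ ?_
  obtain ⟨U, hU, hxU, h⟩ := isLocalCurveFamily_of_isPlot hp x
  refine ⟨U, hU, hxU, fun {m g} hg hgs ↦ ?_⟩
  obtain ⟨F, hF⟩ := h hg hgs
  exact IsCurveFamily.isPlot ⟨Hom.comp f F, fun u ↦ congrArg (tangentBundleMap f) (hF u)⟩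

theorem dSmooth_tangentMap (k : ℕ) {X Y : DiffSp} (f : Hom X Y) :
    DSmooth (tangentMap k f) := fun n _ hp ↦
  isPlot_tangentPow.2 ⟨f.smooth n _ (isPlot_tangentPow.1 hp).1,
    fun j ↦ dSmooth_tangentBundleMap f n _ ((isPlot_tangentPow.1 hp).2 j)⟩

/-! ## Tangent bundles of products -/

/-- The derivative of a smooth function along a curve in a finite product is the sum of the
derivatives along the components of the curve. -/
theorem deriv₀_comp_pi {n : ℕ} {X : Fin n → DiffSp} (f : Hom (DiffSp.pi X) DiffSp.real)
    (γ : Hom DiffSp.real (DiffSp.pi X)) :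
    deriv₀ (Hom.comp f γ) = ∑ i, deriv₀ (Hom.comp f (Hom.piLift
      (Function.update (fun l ↦ Hom.const (γ (0 : ℝ) l)) i (Hom.comp (Hom.piProj i) γ)))) := by
  -- Each component gets its own time. On the diagonal `G` is `f ∘ γ`, on the `i`-th axis it is the
  -- `i`-th summand, and the derivative of `G` at the origin is linear.
  let G : EuclideanSpace ℝ (Fin n) → ℝ := fun s ↦ f (fun i ↦ γ (s i) i)
  have hG : ContDiff ℝ ∞ G := f.smooth n (fun s i ↦ γ (s i) i) (DiffSp.isPlot_pi.2 fun i ↦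
    (Hom.comp (Hom.piProj i) γ).smooth n (fun s ↦ (s i : ℝ))
      (ContDiff.isPlot (X := ℝ) (by fun_prop)))
  have hG0 : HasFDerivAt G (fderiv ℝ G 0) 0 := (hG.differentiable (by simp) 0).hasFDerivAt
  have key : ∀ v : EuclideanSpace ℝ (Fin n),
      HasDerivAt (fun t : ℝ ↦ G (t • v)) (fderiv ℝ G 0 v) 0 := by
    intro v
    have h1 : HasDerivAt (fun t : ℝ ↦ t • v) v 0 := by
      simpa using (hasDerivAt_id (0 : ℝ)).smul_const v
    have h2 : HasFDerivAt G (fderiv ℝ G 0) ((0 : ℝ) • v) := by simpa using hG0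
    exact h2.comp_hasDerivAt (0 : ℝ) h1
  have hsum : (∑ i, EuclideanSpace.single i (1 : ℝ) : EuclideanSpace ℝ (Fin n)) =
      WithLp.toLp 2 fun _ ↦ 1 := by
    ext l
    simp [Finset.sum_apply, Pi.single_apply]
  have h1 : deriv₀ (Hom.comp f γ) =
      fderiv ℝ G 0 (∑ i, EuclideanSpace.single i (1 : ℝ)) := by
    rw [hsum, ← (key _).deriv]
    refine congrArg (fun g : ℝ → ℝ ↦ deriv g 0) (funext fun t ↦ ?_)
    refine congrArg f.toFun (funext fun i ↦ ?_)
    simp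
  rw [h1, map_sum]
  refine Finset.sum_congr rfl fun i _ ↦ ?_
  rw [← (key _).deriv]
  refine congrArg (fun g : ℝ → ℝ ↦ deriv g 0) (funext fun t ↦ ?_)
  refine congrArg f.toFun (funext fun l ↦ ?_)
  by_cases hl : l = i
  · subst hl
    simp [Hom.piLift, Hom.comp, Hom.piProj]
  · simp [Hom.piLift, Hom.const, hl]

/-- In the sum for the derivative of a test function, the `i`-th term factors through the inclusion
of `X i` with the other coordinates frozen at time zero, so it depends only on the velocity of the
`i`-th component. -/
theorem curveTangent_pi_ext {n : ℕ} {X : Fin n → DiffSp} {γ γ' : Hom DiffSp.real (DiffSp.pi X)}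
    (h : ∀ i, curveTangent (Hom.comp (Hom.piProj i) γ) =
      curveTangent (Hom.comp (Hom.piProj i) γ')) : curveTangent γ = curveTangent γ' := by
  have h0 : γ (0 : ℝ) = γ' (0 : ℝ) := funext fun i ↦ (curveTangent_eq_iff.1 (h i)).1
  refine curveTangent_eq_iff.2 ⟨h0, fun f ↦ ?_⟩
  rw [deriv₀_comp_pi, deriv₀_comp_pi]
  refine Finset.sum_congr rfl fun i _ ↦ ?_
  rw [← h0]
  let incl : Hom (X i) (DiffSp.pi X) :=
    Hom.piLift (Function.update (fun l ↦ Hom.const (γ (0 : ℝ) l)) i (Hom.id (X i)))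
  have e : ∀ c : Hom DiffSp.real (X i), Hom.piLift
      (Function.update (fun l ↦ Hom.const (γ (0 : ℝ) l)) i c) = Hom.comp incl c := by
    intro c
    refine Hom.ext (funext fun t ↦ funext fun l ↦ ?_)
    by_cases hl : l = i
    · subst hl
      simp [incl, Hom.piLift, Hom.comp, Hom.id]
    · simp [incl, Hom.piLift, Hom.const, Hom.comp, hl]
  rw [e, e]
  exact (curveTangent_eq_iff.1 (h i)).2 (Hom.comp f incl)

/-- Reduces to a product over `Fin 2`, from which the tangent map of `out` carries the equality
back. -/
theorem curveTangent_prod_ext {X Y : DiffSp} {γ γ' : Hom DiffSp.real (DiffSp.prod X Y)}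
    (h₁ : curveTangent (Hom.comp Hom.fst γ) = curveTangent (Hom.comp Hom.fst γ'))
    (h₂ : curveTangent (Hom.comp Hom.snd γ) = curveTangent (Hom.comp Hom.snd γ')) :
    curveTangent γ = curveTangent γ' := by
  let Z : Fin 2 → DiffSp := ![X, Y]
  let out : Hom (DiffSp.pi Z) (DiffSp.prod X Y) :=
    Hom.pair (Hom.piProj (X := Z) 0) (Hom.piProj (X := Z) 1)
  let inn (γ : Hom DiffSp.real (DiffSp.prod X Y)) : Hom DiffSp.real (DiffSp.pi Z) :=
    Hom.piLift (Fin.cases (Hom.comp Hom.fst γ) (Fin.cases (Hom.comp Hom.snd γ) fun i ↦ i.elim0))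
  have : curveTangent (inn γ) = curveTangent (inn γ') :=
    curveTangent_pi_ext (Fin.cases h₁ (Fin.cases h₂ fun i ↦ i.elim0))
  exact congrArg (tangentBundleMap out) this

/-- `tangentPi` is built from chosen representatives; any others give the same vector. -/
theorem tangentPowProj_tangentPi {k n : ℕ} {X : Fin n → DiffSp} (v : ∀ i, (X i).tangentPow k)
    (j : Fin k) (γ : ∀ i, Hom DiffSp.real (X i))
    (h : ∀ i, tangentPowProj j (v i) = curveTangent (γ i)) :
    tangentPowProj j (tangentPi k v) = curveTangent (Hom.piLift γ) := by
  refine (mk_eq_curveTangent _).trans (curveTangent_pi_ext fun i ↦ ?_)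
  exact (mk_eq_curveTangent_out ((v i).2 j)).symm.trans (h i)

theorem tangentPowProj_tangentProd {k : ℕ} {X Y : DiffSp} (v : X.tangentPow k)
    (w : Y.tangentPow k) (j : Fin k) {γ : Hom DiffSp.real X} {δ : Hom DiffSp.real Y}
    (hv : tangentPowProj j v = curveTangent γ) (hw : tangentPowProj j w = curveTangent δ) :
    tangentPowProj j (tangentProd k v w) = curveTangent (Hom.pair γ δ) := by
  refine (mk_eq_curveTangent _).trans (curveTangent_prod_ext ?_ ?_)
  · exact (mk_eq_curveTangent_out (v.2 j)).symm.trans hv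
  · exact (mk_eq_curveTangent_out (w.2 j)).symm.trans hw

/-- The inverse has the tangent maps of the projections as components. The forward map is smooth
because local curve families of the components can be tupled on the intersection of finitely many
neighbourhoods. -/
theorem isDiffeo_tangentPi (k : ℕ) {n : ℕ} (X : Fin n → DiffSp) :
    IsDiffeo (X := DiffSp.pi fun i ↦ (X i).tangentPow k) (tangentPi k (X := X)) := by
  refine ⟨fun m p hp ↦ ?_, fun v i ↦ tangentMap k (Hom.piProj i) v, fun m p hp ↦ ?_,
    fun v ↦ funext fun i ↦ tangentMap_tangentPi k v i, fun v ↦ ?_⟩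
  · have hp' := fun i ↦ isPlot_tangentPow.1 (DiffSp.isPlot_pi.1 hp i)
    refine isPlot_tangentPow.2 ⟨DiffSp.isPlot_pi.2 fun i ↦ (hp' i).1, fun j ↦ ?_⟩
    refine DiffeologicalSpace.locality fun x ↦ ?_
    choose U hU hxU hf using fun i ↦ isLocalCurveFamily_of_isPlot ((hp' i).2 j) x
    refine ⟨⋂ i, U i, isOpen_iInter_of_finite hU, Set.mem_iInter.2 hxU, fun {l f} hfU hfs ↦ ?_⟩
    choose F hF using fun i ↦ hf i (fun y ↦ Set.mem_iInter.1 (hfU y) i) hfs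
    exact IsCurveFamily.isPlot ⟨Hom.piLift F,
      fun u ↦ tangentPowProj_tangentPi (p (f u)) j _ fun i ↦ hF i u⟩
  · exact DiffSp.isPlot_pi.2 fun i ↦ dSmooth_tangentMap k (Hom.piProj i) m p hp
  · refine tangentPow_ext rfl fun j ↦ ?_
    refine (tangentPowProj_tangentPi _ j
      (fun i ↦ Hom.comp (Hom.piProj i) (v.2 j).out.1) fun i ↦ ?_).trans
      (mk_eq_curveTangent_out (v.2 j)).symm
    exact congrArg (tangentBundleMap (Hom.piProj i)) (mk_eq_curveTangent_out (v.2 j))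

theorem tangentMap_fst_tangentProd {k : ℕ} {X Y : DiffSp} (v : X.tangentPow k)
    (w : Y.tangentPow k) : tangentMap k Hom.fst (tangentProd k v w) = v :=
  Sigma.ext rfl (heq_of_eq (funext fun j ↦ (v.2 j).out_eq))

theorem tangentMap_snd_tangentProd {k : ℕ} {X Y : DiffSp} (v : X.tangentPow k)
    (w : Y.tangentPow k) : tangentMap k Hom.snd (tangentProd k v w) = w :=
  Sigma.ext rfl (heq_of_eq (funext fun j ↦ (w.2 j).out_eq))

theorem isDiffeo_tangentProd (k : ℕ) (X Y : DiffSp) :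
    IsDiffeo (X := DiffSp.prod (X.tangentPow k) (Y.tangentPow k))
      (fun v ↦ tangentProd k v.1 v.2) := by
  refine ⟨fun m p hp ↦ ?_, fun v ↦ (tangentMap k Hom.fst v, tangentMap k Hom.snd v),
    fun m p hp ↦ ?_, fun v ↦ Prod.ext (tangentMap_fst_tangentProd v.1 v.2)
      (tangentMap_snd_tangentProd v.1 v.2), fun v ↦ ?_⟩
  · have hp₁ := isPlot_tangentPow.1 (DiffSp.isPlot_prod.1 hp).1
    have hp₂ := isPlot_tangentPow.1 (DiffSp.isPlot_prod.1 hp).2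
    refine isPlot_tangentPow.2 ⟨DiffSp.isPlot_prod.2 ⟨hp₁.1, hp₂.1⟩, fun j ↦ ?_⟩
    refine DiffeologicalSpace.locality fun x ↦ ?_
    obtain ⟨U, hU, hxU, hf⟩ := isLocalCurveFamily_of_isPlot (hp₁.2 j) x
    obtain ⟨V, hV, hxV, hg⟩ := isLocalCurveFamily_of_isPlot (hp₂.2 j) x
    refine ⟨U ∩ V, hU.inter hV, ⟨hxU, hxV⟩, fun {l f} hfU hfs ↦ ?_⟩
    obtain ⟨F, hF⟩ := hf (fun y ↦ (hfU y).1) hfs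
    obtain ⟨G, hG⟩ := hg (fun y ↦ (hfU y).2) hfs
    exact IsCurveFamily.isPlot ⟨Hom.pair F G,
      fun u ↦ tangentPowProj_tangentProd (p (f u)).1 (p (f u)).2 j (hF u) (hG u)⟩
  · exact DiffSp.isPlot_prod.2
      ⟨dSmooth_tangentMap k Hom.fst m p hp, dSmooth_tangentMap k Hom.snd m p hp⟩
  · refine tangentPow_ext rfl fun j ↦ ?_
    refine (tangentPowProj_tangentProd _ _ j (γ := Hom.comp Hom.fst (v.2 j).out.1)
      (δ := Hom.comp Hom.snd (v.2 j).out.1) ?_ ?_).trans (mk_eq_curveTangent_out (v.2 j)).symm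
    · exact congrArg (tangentBundleMap Hom.fst) (mk_eq_curveTangent_out (v.2 j))
    · exact congrArg (tangentBundleMap Hom.snd) (mk_eq_curveTangent_out (v.2 j))

/-! ## Tangent bundles of disjoint unions -/

/-- A smooth function on one summand extends by zero to the disjoint union, so the union has enough
test functions to separate the velocities of that summand. -/
theorem tangentBundleMap_inj_injective {ι : Type} {X : ι → DiffSp} (i : ι) :
    Function.Injective (tangentBundleMap (Hom.inj (X := X) i)) := by
  classical
  rintro ⟨x, v⟩ ⟨y, w⟩ h
  rw [mk_eq_curveTangent_out, mk_eq_curveTangent_out] at h ⊢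
  rw [tangentBundleMap_curveTangent, tangentBundleMap_curveTangent] at h
  obtain ⟨h0, h⟩ := curveTangent_eq_iff.1 h
  refine curveTangent_eq_iff.2 ⟨eq_of_heq (Sigma.mk.inj h0).2, fun f ↦ ?_⟩
  let g : Hom (DiffSp.sigma X) DiffSp.real := Hom.comp (Hom.case (E := DiffSp.unit) fun l ↦
    if hl : l = i then Hom.comp (hl ▸ f) Hom.fst else Hom.const (Y := DiffSp.real) (0 : ℝ))
    (Hom.pair (Hom.id _) Hom.toUnit)
  have hg : ∀ c : Hom DiffSp.real (X i), Hom.comp g (Hom.comp (Hom.inj i) c) = Hom.comp f c := by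
    intro c
    refine Hom.ext (funext fun t ↦ ?_)
    simp [g, Hom.comp, Hom.case, Hom.inj, Hom.pair, Hom.id, Hom.fst]
  have := h g
  rwa [hg, hg] at this

theorem exists_tangentBundleMap_inj {ι : Type} {X : ι → DiffSp} {i : ι} {x : X i}
    (v : TangentSp (DiffSp.sigma X) ⟨i, x⟩) :
    ∃ w : TangentSp (X i) x, tangentBundleMap (Hom.inj i) ⟨x, w⟩ = ⟨⟨i, x⟩, v⟩ := by
  obtain ⟨⟨γ, hγ⟩, rfl⟩ := Quotient.exists_rep v
  obtain ⟨l, γ', rfl⟩ := γ.exists_eq_inj_comp_real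
  obtain rfl : l = i := congrArg Sigma.fst hγ
  obtain rfl : γ' (0 : ℝ) = x := eq_of_heq (Sigma.mk.inj hγ).2
  exact ⟨velocity γ', rfl⟩

/-- A plot of base points lies in one summand, and so does each local curve family above it. The
vectors are lifted to that summand pointwise; since lifts are unique, they agree locally with the
smooth families there. -/
theorem isDiffeo_tangentSigma (k : ℕ) {ι : Type} (X : ι → DiffSp) :
    IsDiffeo (X := DiffSp.sigma fun i ↦ (X i).tangentPow k)
      (fun v ↦ tangentMap k (Hom.inj (X := X) v.1) v.2) := by
  refine IsDiffeo.of_lift ?_ ?_ ?_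
  · rintro n _ ⟨i, q, hq, rfl⟩
    exact dSmooth_tangentMap k (Hom.inj i) n q hq
  · rintro ⟨i, v⟩ ⟨l, w⟩ h
    have h0 : (⟨i, v.1⟩ : Σ i, X i) = ⟨l, w.1⟩ := congrArg Sigma.fst h
    obtain rfl : i = l := congrArg Sigma.fst h0
    refine congrArg (Sigma.mk i) (tangentPow_ext (eq_of_heq (Sigma.mk.inj h0).2) fun j ↦ ?_)
    exact tangentBundleMap_inj_injective i (congrArg (tangentPowProj j) h)
  · intro n p hp
    obtain ⟨⟨i, q, hq, hpq⟩, hpj⟩ := isPlot_tangentPow.1 hp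
    have hex : ∀ (u : EuclideanSpace ℝ (Fin n)) (j : Fin k), ∃ w : TangentSp (X i) (q u),
        tangentBundleMap (Hom.inj i) ⟨q u, w⟩ = tangentPowProj j (p u) := by
      intro u j
      have hu : (p u).1 = ⟨i, q u⟩ := congrFun hpq u
      generalize p u = v at hu
      obtain ⟨y, v⟩ := v
      subst hu
      exact exists_tangentBundleMap_inj (v j)
    choose w hw using hex
    refine ⟨fun u ↦ ⟨i, ⟨q u, w u⟩⟩, ⟨i, _, isPlot_tangentPow.2 ⟨hq, fun j ↦ ?_⟩, rfl⟩,
      fun u ↦ tangentPow_ext (congrFun hpq u).symm (hw u)⟩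
    refine DiffeologicalSpace.locality fun x ↦ ?_
    obtain ⟨U, hU, hxU, hf⟩ := isLocalCurveFamily_of_isPlot (hpj j) x
    refine ⟨U, hU, hxU, fun {m f} hfU hfs ↦ ?_⟩
    obtain ⟨F, hF⟩ := hf hfU hfs
    obtain ⟨l, F, rfl⟩ := F.exists_eq_inj_comp_prod
    have hF' : ∀ u, tangentBundleMap (Hom.inj i) ⟨q (f u), w (f u) j⟩ = _ :=
      fun u ↦ (hw (f u) j).trans (hF u)
    -- The family and the base points lie in the same summand, as one sees at a single parameter.
    obtain rfl : i = l := congrArg (fun v : (DiffSp.sigma X).tangent ↦ v.1.1) (hF' 0)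
    exact IsCurveFamily.isPlot ⟨F, fun u ↦ tangentBundleMap_inj_injective i (hF' u)⟩

/-! ## The tangent bundle of the reals -/

theorem deriv₀_comp (f γ : Hom DiffSp.real DiffSp.real) :
    deriv₀ (Hom.comp f γ) =
      deriv (F := ℝ) (fun x : ℝ ↦ f x) (γ (0 : ℝ)) * deriv₀ γ :=
  ((f.contDiff_real.differentiable (by simp) _).hasDerivAt.comp (0 : ℝ) γ.hasDerivAt_real).deriv

/-- By the chain rule the identity is the only test function needed. -/
theorem curveTangent_real_eq_iff {γ γ' : Hom DiffSp.real DiffSp.real} :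
    curveTangent γ = curveTangent γ' ↔
      γ (0 : ℝ) = γ' (0 : ℝ) ∧ deriv₀ γ = deriv₀ γ' := by
  rw [curveTangent_eq_iff]
  refine and_congr_right fun h0 ↦ ⟨fun h ↦ h (Hom.id _), fun h f ↦ ?_⟩
  rw [deriv₀_comp, deriv₀_comp, h0, h]

theorem deriv₀_line (a b : ℝ) : deriv₀ (line a b) = b := by
  have : HasDerivAt (fun t : ℝ ↦ a + b * t) (b * 1) 0 :=
    ((hasDerivAt_id (0 : ℝ)).const_mul b).const_add a
  exact this.deriv.trans (mul_one b)

theorem tangentPowProj_tangentReal {k : ℕ} {x : ℝ} {x' : Fin k → ℝ} {j : Fin k}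
    {γ : Hom DiffSp.real DiffSp.real} :
    tangentPowProj j (tangentReal k x x') = curveTangent γ ↔
      x = γ (0 : ℝ) ∧ x' j = deriv₀ γ := by
  have e : tangentPowProj j (tangentReal k x x') = curveTangent (line x (x' j)) :=
    mk_eq_curveTangent _
  have h0 : line x (x' j) (0 : ℝ) = x := show x + x' j * 0 = x by simp
  rw [e, curveTangent_real_eq_iff, h0, deriv₀_line]
  exact Iff.rfl

/-- This is the partial derivative of `F` in the direction `(0, 1)`, restricted to time zero. -/
theorem contDiff_deriv₀ {n : ℕ} (F : Hom (DiffSp.prod (DiffSp.euc n) DiffSp.real) DiffSp.real) :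
    ContDiff ℝ ∞ (fun u : EuclideanSpace ℝ (Fin n) ↦
      deriv₀ (Hom.comp F (Hom.pair (Hom.const (Y := DiffSp.euc n) u) (Hom.id DiffSp.real)))) := by
  have hF := F.contDiff_prod
  let G : EuclideanSpace ℝ (Fin n) × ℝ → ℝ := F.toFun
  have hG : ContDiff ℝ ∞ G := hF
  have h : ContDiff ℝ ∞ (fun u : EuclideanSpace ℝ (Fin n) ↦ fderiv ℝ G (u, 0) (0, 1)) := by
    have h1 : ContDiff ℝ ∞ (fderiv ℝ G) := hG.fderiv_right (by simp)
    exact (h1.comp (contDiff_id.prodMk contDiff_const)).clm_apply contDiff_const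
  convert! h using 1
  funext u
  have h1 : HasDerivAt (fun t : ℝ ↦ (u, t)) ((0 : EuclideanSpace ℝ (Fin n)), (1 : ℝ)) 0 :=
    (hasDerivAt_const (0 : ℝ) u).prodMk (hasDerivAt_id (0 : ℝ))
  exact ((hG.differentiable (by simp) (u, 0)).hasFDerivAt.comp_hasDerivAt (0 : ℝ) h1).deriv

/-- Plots map to the families `x(u) + x'(u) t`. Conversely the coordinate of a vector is the
derivative of any representing curve, so it can be computed from a local smooth family instead of
the chosen representatives. -/
theorem isDiffeo_tangentReal (k : ℕ) :
    IsDiffeo (X := DiffSp.prod DiffSp.real (DiffSp.pi fun _ : Fin k ↦ DiffSp.real))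
      (fun d ↦ tangentReal k d.1 d.2) := by
  refine IsDiffeo.of_lift (fun n p hp ↦ ?_) ?_ fun n p hp ↦ ?_
  · obtain ⟨h0, h⟩ := DiffSp.isPlot_prod.1 hp
    refine isPlot_tangentPow.2 ⟨h0, fun j ↦ IsCurveFamily.isPlot ?_⟩
    have hj := DiffSp.isPlot_pi.1 h j
    let F : Hom (DiffSp.prod (DiffSp.euc n) DiffSp.real) DiffSp.real :=
      Hom.add (Hom.comp ⟨fun u ↦ (p u).1, h0.dSmooth⟩ Hom.fst)
        (Hom.mul (Hom.comp ⟨fun u ↦ (p u).2 j, hj.dSmooth⟩ Hom.fst) Hom.snd)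
    exact ⟨F, fun u ↦ mk_eq_curveTangent _⟩
  · rintro ⟨x, x'⟩ ⟨y, y'⟩ h
    have h0 : x = y := congrArg Sigma.fst h
    refine Prod.ext h0 (funext fun j ↦ ?_)
    have := tangentPowProj_tangentReal.1 ((congrArg (tangentPowProj j) h).trans
      (mk_eq_curveTangent _))
    exact this.2.trans (deriv₀_line _ _)
  · obtain ⟨h0, h⟩ := isPlot_tangentPow.1 hp
    refine ⟨fun u ↦ ((p u).1, fun j ↦ deriv₀ ((p u).2 j).out.1),
      DiffSp.isPlot_prod.2 ⟨h0, DiffSp.isPlot_pi.2 fun j ↦ ?_⟩, fun u ↦ ?_⟩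
    · refine DiffeologicalSpace.locality fun x ↦ ?_
      obtain ⟨U, hU, hxU, hf⟩ := isLocalCurveFamily_of_isPlot (h j) x
      refine ⟨U, hU, hxU, fun {m f} hfU hfs ↦ ?_⟩
      obtain ⟨F, hF⟩ := hf hfU hfs
      have e : (fun u ↦ deriv₀ ((p u).2 j).out.1) ∘ f = fun u ↦ deriv₀
          (Hom.comp F (Hom.pair (Hom.const (Y := DiffSp.euc m) u) (Hom.id DiffSp.real))) :=
        funext fun u ↦ (curveTangent_real_eq_iff.1
          ((mk_eq_curveTangent_out ((p (f u)).2 j)).symm.trans (hF u))).2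
      exact e ▸ contDiff_deriv₀ F
    · refine tangentPow_ext rfl fun j ↦ ?_
      refine Eq.trans ?_ (mk_eq_curveTangent_out ((p u).2 j)).symm
      exact tangentPowProj_tangentReal.2 ⟨((p u).2 j).out.2.symm, rfl⟩

/-! ## The canonical isomorphisms -/

theorem Ty.isDiffeo_toTangent (k : ℕ) : ∀ (τ : Ty) (h : τ.FirstOrder), IsDiffeo (τ.toTangent k h)
  | .real, _ => by
    -- `D real` is a product over `Fin 2`, whereas the tangent space was computed for a binary
    -- product.
    refine IsDiffeo.comp (isDiffeo_tangentReal k)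
      (X := (Ty.real.D k).sem) (f := fun d ↦ (d (0 : Fin 2), d (1 : Fin 2))) ?_
    refine IsDiffeo.of_lift (fun n p hp ↦ ?_) (fun x y h ↦ ?_) fun n p hp ↦ ?_
    · exact DiffSp.isPlot_prod.2 ⟨DiffSp.isPlot_pi.1 hp (0 : Fin 2),
        DiffSp.isPlot_pi.1 hp (1 : Fin 2)⟩
    · exact funext (Fin.cases (congrArg Prod.fst h)
        (Fin.cases (congrArg Prod.snd h) fun i ↦ i.elim0))
    · refine ⟨fun u ↦ Fin.cases (p u).1 (Fin.cases (p u).2 fun i ↦ i.elim0),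
        DiffSp.isPlot_pi.2 ?_, fun u ↦ rfl⟩
      exact Fin.cases (DiffSp.isPlot_prod.1 hp).1
        (Fin.cases (DiffSp.isPlot_prod.1 hp).2 fun i ↦ i.elim0)
  | .prod _ σ, h => (isDiffeo_tangentPi k fun i ↦ (σ i).sem).comp
      (IsDiffeo.piMap fun i ↦ (σ i).isDiffeo_toTangent k (h i))
  | .fn _ _, h => h.elim
  | .variant _ σ, h => (isDiffeo_tangentSigma k fun i ↦ (σ i).sem).comp
      (IsDiffeo.sigmaMap fun i ↦ (σ i).isDiffeo_toTangent k (h i))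
  | .list σ, h => (isDiffeo_tangentSigma k fun m : ℕ ↦ DiffSp.pi fun _ : Fin m ↦ σ.sem).comp
      (IsDiffeo.sigmaMap fun m : ℕ ↦ (isDiffeo_tangentPi k fun _ : Fin m ↦ σ.sem).comp
        (IsDiffeo.piMap fun _ ↦ σ.isDiffeo_toTangent k h))

theorem Ctx.isDiffeo_toTangent (k : ℕ) :
    ∀ (Γ : Ctx) (h : Γ.FirstOrder), IsDiffeo (Γ.toTangent k h)
  | [], _ => by
    refine IsDiffeo.of_lift (fun n p _ ↦ DiffeologicalSpace.constant_plots _)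
      (fun x y _ ↦ rfl) fun n p _ ↦ ⟨fun _ ↦ (), DiffSp.isPlot_unit _, fun u ↦ ?_⟩
    refine tangentPow_ext rfl fun j ↦ ?_
    exact (mk_eq_curveTangent _).trans (mk_eq_curveTangent_out ((p u).2 j)).symm
  | σ :: Γ, h => (isDiffeo_tangentProd k σ.sem (Ctx.sem Γ)).comp
      ((σ.isDiffeo_toTangent k _).prodMap (Ctx.isDiffeo_toTangent k Γ _))

/-! ## Correctness at first order types -/

/-- The curve `γ` represents the base point of `v` and its tangent vectors with index in `o`. -/
def Represents {k : ℕ} (o : Option (Fin k)) {X : DiffSp} (γ : Hom DiffSp.real X)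
    (v : X.tangentPow k) : Prop :=
  v.1 = γ (0 : ℝ) ∧ ∀ j ∈ o, tangentPowProj j v = curveTangent γ

namespace Represents

variable {k : ℕ} {o : Option (Fin k)}

theorem map {X Y : DiffSp} (f : Hom X Y) {γ : Hom DiffSp.real X} {v : X.tangentPow k}
    (h : Represents o γ v) : Represents o (Hom.comp f γ) (tangentMap k f v) :=
  ⟨congrArg f.toFun h.1, fun j hj ↦ congrArg (tangentBundleMap f) (h.2 j hj)⟩

theorem proj {n : ℕ} {X : Fin n → DiffSp} {γ : Hom DiffSp.real (DiffSp.pi X)}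
    {v : ∀ i, (X i).tangentPow k} (h : Represents o γ (tangentPi k v)) (i : Fin n) :
    Represents o (Hom.comp (Hom.piProj i) γ) (v i) :=
  tangentMap_tangentPi k v i ▸ h.map (Hom.piProj i)

theorem pi {n : ℕ} {X : Fin n → DiffSp} {γ : Hom DiffSp.real (DiffSp.pi X)}
    {v : ∀ i, (X i).tangentPow k} (h : ∀ i, Represents o (Hom.comp (Hom.piProj i) γ) (v i)) :
    Represents o γ (tangentPi k v) :=
  ⟨funext fun i ↦ (h i).1, fun j hj ↦ tangentPowProj_tangentPi v j _ fun i ↦ (h i).2 j hj⟩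

theorem fst {X Y : DiffSp} {γ : Hom DiffSp.real (DiffSp.prod X Y)} {v : X.tangentPow k}
    {w : Y.tangentPow k} (h : Represents o γ (tangentProd k v w)) :
    Represents o (Hom.comp Hom.fst γ) v :=
  tangentMap_fst_tangentProd v w ▸ h.map Hom.fst

theorem snd {X Y : DiffSp} {γ : Hom DiffSp.real (DiffSp.prod X Y)} {v : X.tangentPow k}
    {w : Y.tangentPow k} (h : Represents o γ (tangentProd k v w)) :
    Represents o (Hom.comp Hom.snd γ) w :=
  tangentMap_snd_tangentProd v w ▸ h.map Hom.snd

/-- A curve in a disjoint union stays in one summand, here the one containing its starting point;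
injectivity of the tangent map of the inclusion then descends the representation. -/
theorem exists_inj {ι : Type} {X : ι → DiffSp} {i : ι} {γ : Hom DiffSp.real (DiffSp.sigma X)}
    {v : (X i).tangentPow k} (h : Represents o γ (tangentMap k (Hom.inj i) v)) :
    ∃ γ' : Hom DiffSp.real (X i), γ = Hom.comp (Hom.inj i) γ' ∧ Represents o γ' v := by
  obtain ⟨l, γ', rfl⟩ := γ.exists_eq_inj_comp_real
  have h0 : (⟨i, v.1⟩ : Σ i, X i) = ⟨l, γ' (0 : ℝ)⟩ := h.1
  obtain rfl : i = l := congrArg Sigma.fst h0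
  exact ⟨γ', rfl, eq_of_heq (Sigma.mk.inj h0).2,
    fun j hj ↦ tangentBundleMap_inj_injective i (h.2 j hj)⟩

end Represents

/-- Common shape of `lamR` and `evR` at lists. The valuation of `t` changes at each step of the
fold, so it is only asserted to exist; this suffices because the results for the element type hold
at every valuation. -/
theorem Tm.exists_sem_mapList {Γ : Ctx} {σ τ : Ty}
    (t : Tm (Ty.list τ :: σ :: Ty.list σ :: Γ) (Ty.fn σ τ)) (d : Γ.sem) (e : (Ty.list σ).sem) :
    ∃ l : Fin e.1 → τ.sem,
      Hom.toFun ((Tm.lam (Tm.fold (.cons (.app t v1) v0) v0 .nil)).sem d) e = ⟨e.1, l⟩ ∧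
        ∀ i, ∃ d', l i = Hom.toFun (t.sem d') (e.2 i) := by
  obtain ⟨m, v⟩ := e
  change ∃ l : Fin m → τ.sem, Hom.foldAux (Tm.cons (.app t v1) v0).sem Tm.nil.sem
    (((⟨m, v⟩, d) : Ctx.sem (Ty.list σ :: Γ))) m v = ⟨m, l⟩ ∧ _
  -- The valuation contains the whole list, which must stay fixed while the induction shortens the
  -- list being folded.
  generalize (((⟨m, v⟩, d) : Ctx.sem (Ty.list σ :: Γ))) = d'
  induction m with
  | zero => exact ⟨fun i ↦ i.elim0, congrArg (Sigma.mk 0) (funext fun i ↦ i.elim0),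
      fun i ↦ i.elim0⟩
  | succ m ih =>
    obtain ⟨l, hl, hl'⟩ := ih fun i ↦ v i.succ
    refine ⟨_, Tm.sem_cons (t := .app t v1) (u := v0) hl, Fin.cases ⟨_, rfl⟩ hl'⟩

theorem Tm.sem_mapTuple {Γ : Ctx} {n : ℕ} {σ τ : Fin n → Ty}
    (t : ∀ i, Tm (Ctx.ext (Ty.prod n σ :: Γ) n σ) (Ty.fn (σ i) (τ i))) (d : Γ.sem)
    (e : (Ty.prod n σ).sem) :
    Hom.toFun ((Tm.lam (Tm.letTuple v0
      (.tuple fun i ↦ .app (t i) (.var (.bound n σ i))))).sem d) e =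
        fun i ↦ Hom.toFun ((t i).sem
          (Ctx.extend (Γ := Ty.prod n σ :: Γ) (e, d) n σ e)) (e i) := by
  refine (Tm.sem_letTuple (Γ := Ty.prod n σ :: Γ) v0
    (.tuple fun i ↦ .app (t i) (.var (.bound n σ i))) (e, d)).trans (funext fun i ↦ ?_)
  exact congrArg (Hom.toFun _) (Var.sem_bound_extend _ n _ _ i)

theorem Tm.sem_lamR_real {k : ℕ} {Γ : Ctx} (d : Γ.sem) (e : (Ty.real.D k).sem) :
    Hom.toFun ((Tm.lamR k .real trivial).sem d) e =
      (Tm.pair (v0.wkN k _) (.lam (.tuple fun i ↦ .mul (.var (.s (.bound k _ i))) v0))).sem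
        (Ctx.extend (Γ := Ty.real :: Ty.vec k :: Ty.real.D k :: Γ)
          (e (0 : Fin 2), (e (1 : Fin 2), (e, d))) k (fun _ ↦ Ty.real) (e (1 : Fin 2))) :=
  Tm.sem_letTuple (σ := fun _ : Fin k ↦ Ty.real)
    (v1 (Γ := Ty.real.D k :: Γ) (a := Ty.vec k) (b := Ty.real))
    (Tm.pair (v0.wkN k _) (.lam (.tuple fun i ↦ .mul (.var (.s (.bound k _ i))) v0)))
    (e (0 : Fin 2), (e (1 : Fin 2), (e, d)))

theorem Tm.primal_lamR {k : ℕ} {Γ : Ctx} (d : Γ.sem) (e : (Ty.real.D k).sem) :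
    Ty.primal (Hom.toFun ((Tm.lamR k .real trivial).sem d) e) = e (0 : Fin 2) := by
  rw [sem_lamR_real]
  exact Tm.sem_wkN v0 k _ _ _

theorem Tm.backprop_lamR {k : ℕ} {Γ : Ctx} (d : Γ.sem) (e : (Ty.real.D k).sem) (z : ℝ)
    (j : Fin k) : Ty.backprop (Hom.toFun ((Tm.lamR k .real trivial).sem d) e) z j =
      HMul.hMul (α := ℝ) (β := ℝ) ((e (1 : Fin 2) : (Ty.vec k).sem) j) z := by
  rw [sem_lamR_real]
  exact congrArg (fun a : ℝ ↦ a * z) (Var.sem_bound_extend _ k _ _ j)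

/-- The terms `lamR` send tangent vectors represented by a curve to related points. -/
theorem Represents.rel_lamR {k : ℕ} {o : Option (Fin k)} : ∀ (τ : Ty) (h : τ.FirstOrder) {Γ : Ctx}
    (d : Γ.sem) {γ : Hom DiffSp.real τ.sem} {e : (τ.D k).sem},
      Represents o γ (τ.toTangent k h e) →
        τ.Rel o γ (Hom.toFun ((Tm.lamR k τ h).sem d) e)
  | .real, _, _, d, γ, e, hr => by
    refine ⟨(Tm.primal_lamR d e).trans hr.1, fun j hj z ↦ ?_⟩
    refine (Tm.backprop_lamR d e z j).trans ((mul_comm _ _).trans (congrArg (z * ·) ?_))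
    exact (tangentPowProj_tangentReal.1 (hr.2 j hj)).2
  | .prod n σ, h, Γ, d, γ, e, hr => by
    refine Ty.Rel.congr (τ := .prod n σ) (fun i ↦ ?_) rfl
      (Tm.sem_mapTuple (fun i ↦ Tm.lamR k (σ i) (h i)) d e)
    exact Represents.rel_lamR (σ i) (h i) _ (hr.proj i)
  | .fn _ _, h, _, _, _, _, _ => h.elim
  | .variant n σ, h, Γ, d, γ, e, hr => by
    obtain ⟨i, e⟩ := e
    obtain ⟨γ', hγ', hr'⟩ := hr.exists_inj
    exact ⟨γ', hγ', Represents.rel_lamR (σ i) (h i) _ hr'⟩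
  | .list σ, h, Γ, d, γ, e, hr => by
    obtain ⟨l, hl, hl'⟩ := Tm.exists_sem_mapList (Tm.lamR k σ h) d e
    obtain ⟨γ', hγ', hr'⟩ := hr.exists_inj
    refine Ty.Rel.congr (τ := .list σ) ⟨fun i ↦ Hom.comp (Hom.piProj i) γ', hγ', fun i ↦ ?_⟩ rfl hl
    obtain ⟨d', hd'⟩ := hl' i
    exact (Represents.rel_lamR σ h d' (hr'.proj i)).congr rfl hd'

/-- The terms `evR` send points related to a curve to tangent vectors represented by it. -/
theorem Ty.Rel.represents_evR {k : ℕ} {o : Option (Fin k)} : ∀ (τ : Ty) (h : τ.FirstOrder)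
    {Γ : Ctx} (d : Γ.sem) {γ : Hom DiffSp.real τ.sem} {e : (τ.Drev k).sem}, τ.Rel o γ e →
      Represents o γ (τ.toTangent k h (Hom.toFun ((Tm.evR k τ h).sem d) e))
  | .real, _, _, d, γ, e, hr => by
    refine ⟨hr.1, fun j hj ↦ tangentPowProj_tangentReal.2 ⟨hr.1, ?_⟩⟩
    -- Evaluating the backpropagator at `1` extracts the derivative.
    exact (hr.2 j hj 1).trans (one_mul _)
  | .prod n σ, h, Γ, d, γ, e, hr => by
    refine (congrArg (Represents o γ <| Ty.toTangent k (.prod n σ) h ·)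
      (Tm.sem_mapTuple (fun i ↦ Tm.evR k (σ i) (h i)) d e)).mpr ?_
    exact Represents.pi fun i ↦ Ty.Rel.represents_evR (σ i) (h i) _ (hr i)
  | .fn _ _, h, _, _, _, _, _ => h.elim
  | .variant n σ, h, Γ, d, γ, e, hr => by
    obtain ⟨i, e⟩ := e
    obtain ⟨γ', rfl, hr'⟩ := hr
    exact (Ty.Rel.represents_evR (σ i) (h i) _ hr').map _
  | .list σ, h, Γ, d, γ, e, hr => by
    obtain ⟨l, hl, hl'⟩ := Tm.exists_sem_mapList (Tm.evR k σ h) d e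
    obtain ⟨γ', rfl, hr'⟩ := hr
    have hp : Represents o (Hom.piLift γ') (tangentPi k fun i ↦ σ.toTangent k h (l i)) := by
      refine Represents.pi fun i ↦ ?_
      obtain ⟨d', hd'⟩ := hl' i
      exact hd' ▸ Ty.Rel.represents_evR σ h d' (hr' i)
    have := hp.map (Hom.inj (X := fun m : ℕ ↦ DiffSp.pi fun _ : Fin m ↦ σ.sem) e.1)
    exact (congrArg (Represents o _ <| Ty.toTangent k (.list σ) h ·) hl).mpr this

/-- The substitution `lamR` denotes a map sending tangent vectors represented by a curve to related
points. -/
theorem Ctx.exists_sem_lamR (k : ℕ) : ∀ (Γ : Ctx) (h : Γ.FirstOrder)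
    (d : Ctx.sem (List.map (Ty.D k) Γ)), ∃ d' : Ctx.sem (List.map (Ty.Drev k) Γ),
      (∀ ⦃τ⦄ (x : Var (List.map (Ty.Drev k) Γ) τ), (Sub.lamR k Γ h x).sem d = x.sem d') ∧
        ∀ (o : Option (Fin k)) (γ : Hom DiffSp.real Γ.sem),
          Represents o γ (Γ.toTangent k h d) → Ctx.Rel o Γ γ d'
  | [], _, _ => ⟨(), fun _ x ↦ (nomatch x), fun _ _ _ ↦ trivial⟩
  | σ :: Γ, h, d => by
    obtain ⟨d', hd', hr⟩ := Ctx.exists_sem_lamR k Γ (fun τ hτ ↦ h τ (by simp [hτ])) d.2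
    refine ⟨(Hom.toFun ((Tm.lamR k σ (h σ (by simp))).sem d) d.1, d'), fun τ x ↦ ?_,
      fun o γ hγ ↦ ⟨?_, ?_⟩⟩
    · cases x with
      | z => rfl
      | s x => exact (Tm.sem_wk _ d.1 d.2).trans (hd' x)
    · exact Represents.rel_lamR σ _ _ hγ.fst
    · exact hr o _ hγ.snd

/-! ### Assembling the correctness statement -/

theorem Tm.represents_revAD {k : ℕ} {Γ : Ctx} {τ : Ty} (hΓ : Γ.FirstOrder) (hτ : τ.FirstOrder)
    (t : Tm Γ τ) (d : Ctx.sem (List.map (Ty.D k) Γ)) (o : Option (Fin k))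
    (γ : Hom DiffSp.real Γ.sem) (hγ : Represents o γ (Γ.toTangent k hΓ d)) :
    Represents o (Hom.comp t.sem γ) (τ.toTangent k hτ ((t.revAD k hΓ hτ).sem d)) := by
  obtain ⟨d', hd', hr⟩ := Ctx.exists_sem_lamR k Γ hΓ d
  refine Ty.Rel.represents_evR τ hτ d ?_
  exact (t.rel (hr o γ hγ)).congr rfl ((t.Drev k).sem_subst _ d d' hd')

/-- Base points are compared with the constant curve and index `none`, which also covers `k = 0`;
the `j`-th vectors are compared with a curve representing the `j`-th input vector and index `some
j`. -/
theorem Tm.toTangent_revAD {k : ℕ} {Γ : Ctx} {τ : Ty} (hΓ : Γ.FirstOrder) (hτ : τ.FirstOrder)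
    (t : Tm Γ τ) (d : Ctx.sem (List.map (Ty.D k) Γ)) :
    τ.toTangent k hτ ((t.revAD k hΓ hτ).sem d) = tangentMap k t.sem (Γ.toTangent k hΓ d) := by
  refine tangentPow_ext ?_ fun j ↦ ?_
  · exact (t.represents_revAD hΓ hτ d none (Hom.const (Γ.toTangent k hΓ d).1)
      ⟨rfl, fun _ hj ↦ nomatch hj⟩).1
  · have hγ := mk_eq_curveTangent_out ((Γ.toTangent k hΓ d).2 j)
    have := t.represents_revAD hΓ hτ d (some j) _ ⟨congrArg Sigma.fst hγ, fun l hl ↦ by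
      obtain rfl : j = l := Option.some.inj hl
      exact hγ⟩
    exact (this.2 j rfl).trans (congrArg (tangentBundleMap t.sem) hγ).symm

end RevAD

end

theorem theorem3 (k : ℕ) (Γ : RevAD.Ctx) (τ : RevAD.Ty) (hΓ : Γ.FirstOrder) (hτ : τ.FirstOrder)
    (t : RevAD.Tm Γ τ) :
    RevAD.IsDiffeo (Γ.toTangent k hΓ) ∧ RevAD.IsDiffeo (τ.toTangent k hτ) ∧
      ∀ d : RevAD.Ctx.sem (List.map (RevAD.Ty.D k) Γ),
        τ.toTangent k hτ ((t.revAD k hΓ hτ).sem d) =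
          RevAD.tangentMap k t.sem (Γ.toTangent k hΓ d) :=
  ⟨Γ.isDiffeo_toTangent k hΓ, τ.isDiffeo_toTangent k hτ, t.toTangent_revAD hΓ hτ⟩
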